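/- Let $F$ be a finite field, $A$ a finite set, and $\mathcal{R}$ a partial order on $A$. Write $\mathrm{Int}^\circ(\mathcal{R})=\{[i,j] : i\prec_{\mathcal{R}} j\}$ for the set of proper intervals, ordered by inclusion. Let $\mathrm{UT}_{\mathcal{R}}$ be the pattern group of all $A\times A$ matrices $u$ over $F$ with $u_{ii}=1$ for all $i$ and $u_{ij}=0$ unless $i\preceq_{\mathcal{R}} j$. A partial order $\mathcal{Q}$ on $A$ is a subposet of $\mathcal{R}$ if $i\preceq_{\mathcal{Q}} j$ implies $i\preceq_{\mathcal{R}} j$; then $\mathrm{UT}_{\mathcal{Q}}\subseteq \mathrm{UT}_{\mathcal{R}}$. Let $\mathrm{NPtt}(\mathcal{R})$ be the set of all normal subgroups of $\mathrm{UT}_{\mathcal{R}}$ of the form $\mathrm{UT}_{\mathcal{P}}$ with $\mathcal{P}$ a subposet of $\mathcal{R}$. An $\mathcal{R}$-partition is a set $\lambda\subseteq\mathrm{Int}^\circ(\mathcal{R})$ such that for all $I\subseteq J$ in $\lambda$ the interval $\{K\in \mathrm{Int}^\circ(\mathcal{R}) : I\subseteq K\subseteq J\}$ is totally ordered by inclusion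 if and only if $I=J$. It is non-nesting if it is an antichain in $\mathrm{Int}^\circ(\mathcal{R})$; let $\mathrm{pp}_{\mathrm{nn}}(\mathcal{R})$ be the set of non-nesting $\mathcal{R}$-partitions. For $[i,j]\in\mathrm{Int}^\circ(\mathcal{R})$ let $\mathcal{R}_{[i,j]}$ be the subposet of $\mathcal{R}$ with $k\prec l$ if and only if $k\prec_{\mathcal{R}} l$ and $[k,l]\not\subseteq[i,j]$. For $\lambda\in\mathrm{pp}_{\mathrm{nn}}(\mathcal{R})$ let $\mathrm{UT}_\lambda=\bigcap_{[i,j]\in\lambda}\mathrm{UT}_{\mathcal{R}_{[i,j]}}$ (intersection taken in $\mathrm{UT}_{\mathcal{R}}$, so $\mathrm{UT}_\emptyset=\mathrm{UT}_{\mathcal{R}}$). The supercharacter $\chi^\lambda$ of the normal lattice supercharacter theory of $\mathrm{UT}_{\mathcal{R}}$ given by $\mathrm{NPtt}(\mathcal{R})$ is $$\chi^\lambda=\sum_{\psi}\psi(1)\,\psi,$$ where $\psi$ runs over the irreducible complex characters of $\mathrm{UT}_{\mathcal{R}}$ with $\mathrm{UT}_\lambda\subseteq\ker\psi$ and $O\not\subseteq\ker\psi$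 for every $O$ covering $\mathrm{UT}_\lambda$ in $\mathrm{NPtt}(\mathcal{R})$ (ordered by inclusion). Let $\mathcal{Q}$ be a subposet of $\mathcal{R}$, let $\lambda\in\mathrm{pp}_{\mathrm{nn}}(\mathcal{R})$, and put $\lambda_{\mathcal{Q}}=\{[i,j]\in\lambda : i\prec_{\mathcal{Q}} j\}\in\mathrm{pp}_{\mathrm{nn}}(\mathcal{Q})$. For $\nu \in \mathrm{pp}_{\mathrm{nn}}(\mathcal{Q})$ (in particular for $\nu=\lambda_{\mathcal{Q}}$) the subgroup $\mathrm{UT}_\nu\subseteq\mathrm{UT}_{\mathcal{Q}}$ and the supercharacter $\chi^\nu$ of $\mathrm{UT}_{\mathcal{Q}}$ are formed with respect to $\mathcal{Q}$. Then $$\mathrm{Res}^{\mathrm{UT}_{\mathcal{R}}}_{\mathrm{UT}_{\mathcal{Q}}}(\chi^\lambda)=\frac{1}{|\mathrm{UT}_{\lambda_{\mathcal{Q}}}/(\mathrm{UT}_\lambda\cap\mathrm{UT}_{\mathcal{Q}})|}\,\frac{\chi^\lambda(1)}{\chi^{\lambda_{\mathcal{Q}}}(1)}\sum_{\substack{\nu\in\mathrm{pp}_{\mathrm{nn}}(\mathcal{Q})\\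 \mathrm{UT}_{\lambda_{\mathcal{Q}}}\supseteq\mathrm{UT}_\nu\supseteq\mathrm{UT}_\lambda\cap\mathrm{UT}_{\mathcal{Q}}}}\chi^\nu .$$ -/

import Mathlib

/-! Partial orders on `A` are terms `R : PartialOrder A`, since several orders on the same set are used
at once.  An interval `[i,j]` is recorded by the pair `(i, j)` of its endpoints. -/

/-- `Q` is a subposet of `R` (both are partial orders on the same set). -/
def IsSubposet {A : Type*} (Q R : PartialOrder A) : Prop :=
  ∀ i j : A, Q.le i j → R.le i j

/-- The set `Int°(R)` of proper intervals `[i,j]`, `i ≺ j`. -/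
def properInt {A : Type*} (R : PartialOrder A) : Set (A × A) :=
  {p | R.lt p.1 p.2}

/-- Inclusion of intervals: `[i,j] ⊆ [k,l]` iff `k ≼ i` and `j ≼ l`. -/
def IntLE {A : Type*} (R : PartialOrder A) (p q : A × A) : Prop :=
  R.le q.1 p.1 ∧ R.le p.2 q.2

/-- `IntLE` is containment of the underlying intervals. -/
theorem intLE_iff_subset {A : Type*} (R : PartialOrder A) (p q : A × A) (hp : p ∈ properInt R) :
    IntLE R p q ↔ {x | R.le p.1 x ∧ R.le x p.2} ⊆ {x | R.le q.1 x ∧ R.le x q.2} := by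
  have hle : R.le p.1 p.2 := @le_of_lt A R.toPreorder _ _ hp
  constructor
  · rintro ⟨h1, h2⟩ x ⟨hx1, hx2⟩
    exact ⟨R.le_trans _ _ _ h1 hx1, R.le_trans _ _ _ hx2 h2⟩
  · intro h
    exact ⟨(h ⟨R.le_refl _, hle⟩).1, (h ⟨hle, R.le_refl _⟩).2⟩

/-- `R`-partitions: sets of proper intervals such that the interval of `Int°(R)` between two
(comparable) members is totally ordered if and only if the two members coincide. -/
def IsPosetPartition {A : Type*} (R : PartialOrder A) (lam : Set (A × A)) : Prop :=
  lam ⊆ properInt R ∧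
    ∀ p ∈ lam, ∀ q ∈ lam, IntLE R p q →
      (IsChain (IntLE R) {r | r ∈ properInt R ∧ IntLE R p r ∧ IntLE R r q} ↔ p = q)

/-- Non-nesting `R`-partitions: those that are antichains of `Int°(R)`. -/
def nonNesting {A : Type*} (R : PartialOrder A) : Set (Set (A × A)) :=
  {lam | IsPosetPartition R lam ∧ IsAntichain (IntLE R) lam}

/-- The non-nesting `R`-partitions are exactly the antichains of `Int°(R)`. -/
theorem mem_nonNesting_iff {A : Type*} (R : PartialOrder A) (lam : Set (A × A)) :
    lam ∈ nonNesting R ↔ lam ⊆ properInt R ∧ IsAntichain (IntLE R) lam := by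
  constructor
  · rintro ⟨h, h'⟩
    exact ⟨h.1, h'⟩
  · rintro ⟨h, h'⟩
    refine ⟨⟨h, fun p hp q hq hpq => ?_⟩, h'⟩
    have e : p = q := h'.eq hp hq hpq
    subst e
    refine ⟨fun _ => rfl, fun _ => ?_⟩
    rintro ⟨a, b⟩ ⟨-, ha1, ha2⟩ ⟨c, d⟩ ⟨-, hc1, hc2⟩ hne
    exact absurd (Prod.ext
      (R.le_antisymm _ _ (R.le_trans _ _ _ ha1.1 hc2.1) (R.le_trans _ _ _ hc1.1 ha2.1))
      (R.le_antisymm _ _ (R.le_trans _ _ _ ha2.2 hc1.2) (R.le_trans _ _ _ hc2.2 ha1.2))) hne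

/-- `λ_Q`, the set of those `[i,j] ∈ λ` with `i ≺_Q j`. -/
def restrictPart {A : Type*} (Q : PartialOrder A) (lam : Set (A × A)) : Set (A × A) :=
  {p | p ∈ lam ∧ Q.lt p.1 p.2}

theorem restrictPart_mem_nonNesting {A : Type*} {Q R : PartialOrder A} (h : IsSubposet Q R)
    {lam : Set (A × A)} (hlam : lam ∈ nonNesting R) : restrictPart Q lam ∈ nonNesting Q := by
  rw [mem_nonNesting_iff] at hlam ⊢
  refine ⟨fun p hp => hp.2, fun p hp q hq hne hpq => ?_⟩
  exact hlam.2 hp.1 hq.1 hne ⟨h _ _ hpq.1, h _ _ hpq.2⟩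

/-- The subposet `R_{[i,j]}` of `R`: `k ≺ l` iff `[k,l] ∈ Int°(R)` is not contained in `[i,j]`. -/
@[reducible]
def removeBelow {A : Type*} (R : PartialOrder A) (p : A × A) : PartialOrder A where
  le k l := k = l ∨ (R.lt k l ∧ ¬ IntLE R (k, l) p)
  lt k l := R.lt k l ∧ ¬ IntLE R (k, l) p
  le_refl k := Or.inl rfl
  le_trans k l m := by
    rintro (rfl | ⟨h1, h2⟩) (rfl | ⟨h3, h4⟩)
    · exact Or.inl rfl
    · exact Or.inr ⟨h3, h4⟩
    · exact Or.inr ⟨h1, h2⟩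
    · refine Or.inr ⟨@lt_trans A R.toPreorder _ _ _ h1 h3, fun h => h2 ⟨h.1, ?_⟩⟩
      exact R.le_trans _ _ _ (@le_of_lt A R.toPreorder _ _ h3) h.2
  le_antisymm k l := by
    rintro (rfl | ⟨h1, -⟩) (h | ⟨h3, -⟩)
    · rfl
    · rfl
    · exact h.symm
    · exact absurd h3 (@lt_asymm A R.toPreorder _ _ h1)
  lt_iff_le_not_ge k l := by
    constructor
    · rintro h
      refine ⟨Or.inr h, ?_⟩
      rintro (rfl | h')
      · exact absurd h.1 (@lt_irrefl A R.toPreorder _)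
      · exact absurd h.1 (@lt_asymm A R.toPreorder _ _ h'.1)
    · rintro ⟨rfl | h, h'⟩
      · exact absurd (Or.inl rfl) h'
      · exact h

/-- The invertible matrices supported on the intervals of `R` with ones on the diagonal. -/
def patternMonoid {A : Type*} [Fintype A] [DecidableEq A] (F : Type*) [Field F]
    (R : PartialOrder A) : Submonoid (Matrix.GeneralLinearGroup A F) where
  carrier := {u | (∀ i, u.val i i = 1) ∧ ∀ i j, ¬ R.le i j → u.val i j = 0}
  one_mem' := by
    refine ⟨fun i => by simp, fun i j h => ?_⟩
    have : i ≠ j := fun e => h (e ▸ R.le_refl i)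
    simp [this]
  mul_mem' := by
    rintro u v ⟨hu1, hu2⟩ ⟨hv1, hv2⟩
    refine ⟨fun i => ?_, fun i k h => ?_⟩
    · rw [Units.val_mul, Matrix.mul_apply, Finset.sum_eq_single i]
      · rw [hu1, hv1, one_mul]
      · intro j _ hj
        by_cases h1 : R.le i j
        · rw [hv2 j i (fun h2 => hj (R.le_antisymm _ _ h2 h1)), mul_zero]
        · rw [hu2 i j h1, zero_mul]
      · simp
    · rw [Units.val_mul, Matrix.mul_apply]
      refine Finset.sum_eq_zero fun j _ => ?_
      by_cases h1 : R.le i j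
      · rw [hv2 j k (fun h2 => h (R.le_trans _ _ _ h1 h2)), mul_zero]
      · rw [hu2 i j h1, zero_mul]

/-- The pattern group `UT_R` over the finite field `F`.  A function on the intervals of `R` with value
`1` on each `[i,i]` is extended by `0` to a square matrix, so that the convolution product is the
matrix product and `UT_Q ⊆ UT_R` for each subposet `Q` of `R`. -/
def UT {A : Type*} [Fintype A] [DecidableEq A] (F : Type*) [Field F] [Finite F]
    (R : PartialOrder A) : Subgroup (Matrix.GeneralLinearGroup A F) where
  toSubmonoid := patternMonoid F R
  inv_mem' := by
    intro u hu
    have hpos : 0 < orderOf u := orderOf_pos u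
    have h : u ^ (orderOf u - 1) * u = 1 := by
      rw [← pow_succ, Nat.sub_add_cancel hpos, pow_orderOf_eq_one]
    rw [← eq_inv_of_mul_eq_one_left h]
    exact (patternMonoid F R).pow_mem hu _

theorem mem_UT_iff {A : Type*} [Fintype A] [DecidableEq A] {F : Type*} [Field F] [Finite F]
    {R : PartialOrder A} {u : Matrix.GeneralLinearGroup A F} :
    u ∈ UT F R ↔ (∀ i, u.val i i = 1) ∧ ∀ i j, ¬ R.le i j → u.val i j = 0 :=
  Iff.rfl

/-- Every matrix supported on the intervals of `R` with ones on the diagonal lies in `UT_R`: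
invertibility is automatic. -/
theorem exists_mem_UT {A : Type*} [Fintype A] [DecidableEq A] {F : Type*} [Field F] [Finite F]
    {R : PartialOrder A} (M : Matrix A A F) (h1 : ∀ i, M i i = 1)
    (h2 : ∀ i j, ¬ R.le i j → M i j = 0) : ∃ u ∈ UT F R, u.val = M := by
  have hdet : M.det = 1 := by
    obtain ⟨s, hs, hle⟩ := @extend_partialOrder A (@LE.le A R.toLE)
      { refl := R.le_refl, trans := R.le_trans, antisymm := R.le_antisymm }
    classical
    let LO : LinearOrder A :=
      { le := s, lt := fun a b => s a b ∧ ¬ s b a, lt_iff_le_not_ge := fun _ _ => Iff.rfl, le_refl := hs.refl, le_trans := hs.trans, le_antisymm := hs.antisymm,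
        le_total := hs.total, toDecidableLE := Classical.decRel _ }
    have ht : @Matrix.IsUpperTriangular A F _ LO.toLT M := by
      intro i j hij
      refine h2 i j fun h => ?_
      exact hij.2 (hle _ _ h)
    have e := @Matrix.det_of_isUpperTriangular A F M _ _ _ LO ht
    simp only [h1, Finset.prod_const_one] at e
    convert e
  have hu : IsUnit M := (Matrix.isUnit_iff_isUnit_det M).2 (by simp [hdet])
  obtain ⟨u, rfl⟩ := hu
  exact ⟨u, ⟨h1, h2⟩, rfl⟩

theorem UT_mono {A : Type*} [Fintype A] [DecidableEq A] (F : Type*) [Field F] [Finite F]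
    {Q R : PartialOrder A} (h : IsSubposet Q R) : UT F Q ≤ UT F R :=
  fun _ hu => ⟨hu.1, fun i j hij => hu.2 i j fun hq => hij (h i j hq)⟩

/-- `NPtt(R)`: the normal subgroups of `UT_R` of the form `UT_Q` with `Q` a subposet of `R`. -/
def NPtt {A : Type*} [Fintype A] [DecidableEq A] (F : Type*) [Field F] [Finite F]
    (R : PartialOrder A) : Set (Subgroup (UT F R)) :=
  {N | N.Normal ∧ ∃ Q : PartialOrder A, IsSubposet Q R ∧ N = (UT F Q).subgroupOf (UT F R)}

/-- `UT_λ`, the intersection in `UT_R` of the groups `UT_{R_{[i,j]}}` over `[i,j] ∈ λ`. -/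
def lowerUT {A : Type*} [Fintype A] [DecidableEq A] (F : Type*) [Field F] [Finite F]
    (R : PartialOrder A) (lam : Set (A × A)) : Subgroup (Matrix.GeneralLinearGroup A F) :=
  UT F R ⊓ ⨅ p ∈ lam, UT F (removeBelow R p)

/-- `Irr(G)`: the characters of the irreducible complex representations of `G`. -/
def irrChars (G : Type*) [Group G] : Set (G → ℂ) :=
  {ψ | ∃ (n : ℕ) (ρ : Representation ℂ G (Fin n → ℂ)), ρ.IsIrreducible ∧ ρ.character = ψ}

/-- The kernel of a character. -/
def charKer {G : Type*} [Group G] (ψ : G → ℂ) : Set G :=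
  {g | ψ g = ψ 1}

/-- `C(N)`: the covers of `N` in a set of subgroups ordered by inclusion. -/
def latticeCovers {G : Type*} [Group G] (NN : Set (Subgroup G)) (N : Subgroup G) :
    Set (Subgroup G) :=
  {O | O ∈ NN ∧ N < O ∧ ∀ M ∈ NN, N < M → M ≤ O → M = O}

/-- The block of `Irr(G)` attached to `N` in the normal lattice supercharacter theory of `NN`: the
irreducible characters whose kernel contains `N` but contains no cover of `N` in `NN`. -/
def charBlock {G : Type*} [Group G] (NN : Set (Subgroup G)) (N : Subgroup G) : Set (G → ℂ) :=
  {ψ | ψ ∈ irrChars G ∧ (N : Set G) ⊆ charKer ψ ∧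
    ∀ O ∈ latticeCovers NN N, ¬ (O : Set G) ⊆ charKer ψ}

/-- The supercharacter `∑ ψ(1) ψ` over the block attached to `N`. -/
noncomputable def latticeSuperchar {G : Type*} [Group G] (NN : Set (Subgroup G))
    (N : Subgroup G) : G → ℂ :=
  ∑ᶠ ψ ∈ charBlock NN N, ψ 1 • ψ

/-- The supercharacter `χ^λ` of `UT_R`, attached to the normal pattern subgroup `UT_λ`. -/
noncomputable def superchar {A : Type*} [Fintype A] [DecidableEq A] (F : Type*) [Field F]
    [Finite F] (R : PartialOrder A) (lam : Set (A × A)) : UT F R → ℂ :=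
  latticeSuperchar (NPtt F R) ((lowerUT F R lam).subgroupOf (UT F R))

/-- `UT_λ ∩ UT_Q ⊆ UT_{λ_Q}`. -/
theorem lowerUT_inf_le {A : Type*} [Fintype A] [DecidableEq A] (F : Type*) [Field F] [Finite F]
    {Q R : PartialOrder A} (h : IsSubposet Q R) (lam : Set (A × A)) :
    lowerUT F R lam ⊓ UT F Q ≤ lowerUT F Q (restrictPart Q lam) := by
  rintro u ⟨⟨-, hu⟩, hQ⟩
  refine ⟨hQ, ?_⟩
  have hu' : ∀ p ∈ lam, u ∈ UT F (removeBelow R p) := by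
    have hu : u ∈ ⨅ p ∈ lam, UT F (removeBelow R p) := hu
    simpa only [Subgroup.mem_iInf] using hu
  have goal' : ∀ p ∈ restrictPart Q lam, u ∈ UT F (removeBelow Q p) := by
    intro p hp
    refine ⟨hQ.1, fun i j hij => ?_⟩
    by_cases hle : Q.le i j
    · refine (hu' p hp.1).2 i j ?_
      rintro (rfl | ⟨-, h2⟩)
      · exact hij (Or.inl rfl)
      · refine hij ?_
        by_cases e : i = j
        · exact Or.inl e
        · exact Or.inr ⟨@lt_of_le_of_ne A Q _ _ hle e, fun h' => h2 ⟨h _ _ h'.1, h _ _ h'.2⟩⟩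
    · exact hQ.2 i j hle
  change u ∈ ⨅ p ∈ restrictPart Q lam, UT F (removeBelow Q p)
  simpa only [Subgroup.mem_iInf] using goal'

/-! Write `q` for the order of `F`. Conjugation only spreads a nonzero entry to larger intervals, so
the normal pattern subgroups of `UT_R` are the groups `N_D` of matrices vanishing on a lower set `D`
of `Int°(R)` (`UT_mem_NPtt_iff`). The map from `D` to `N_D` reverses inclusion, `N_D` has index
`q^|D|`, and `N_D ⊔ N_E = N_{D ∩ E}` (`lowerUT_sup_lowerUT`). An antichain `λ` is the set of maximal
elements of the lower set `D` it generates, and `UT_λ = N_D`.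

The sum of `ψ(1) ψ` over the irreducible `ψ` trivial on `N_D` is `q^|D|` times the indicator of
`N_D`. Excluding one by one the characters trivial on `N_{D \ {m}}`, for `m` in a set `M` of maximal
elements of `D`, gives `q^|D| · [g = 0 on D \ M] · ∏_{m ∈ M} ([g_m = 0] - 1/q)`
(`finsum_partBlock`). For `M = λ` this is `χ^λ`.

On `UT_Q` all entries outside `Int°(Q)` vanish. Each `m ∈ λ` outside `Int°(Q)` therefore contributes
the constant `1 - 1/q`, and what remains is, up to scalars, the same product for `D' = D ∩ Int°(Q)`
and `M = λ_Q`. The blocks of the `ν` in the sum are disjoint with union the block of `(D', λ_Q)`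
(`finsum_superchar_apply`), so the right-hand sum is this product as well. The constants agree
because the quotient has order `q^(|D'| - |E|)`, with `E` the lower set generated by `λ_Q` in `Q`.
-/

/-! ### Complex characters of a finite group and lattice blocks -/

section CharacterTheory

open scoped MonoidAlgebra

/-- A linear functional on a matrix algebra which does not see the order of products is a multiple
of the trace. -/
theorem Matrix.exists_eq_smul_trace_of_mul_comm {k n : Type*} [Field k] [Fintype n] [DecidableEq n]
    (f : Matrix n n k →ₗ[k] k) (hf : ∀ a b, f (a * b) = f (b * a)) :
    ∃ c : k, ∀ M, f M = c * M.trace := by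
  rcases isEmpty_or_nonempty n with h | ⟨⟨o⟩⟩
  · exact ⟨0, fun M => by rw [Subsingleton.elim M 0]; simp⟩
  -- An off-diagonal matrix unit is the commutator of `E_aa` and `E_ab`; two diagonal units differ
  -- by a commutator.
  have hoff : ∀ a b, a ≠ b → f (Matrix.single a b 1) = 0 := fun a b hab => by
    have := hf (Matrix.single a a 1) (Matrix.single a b 1)
    rwa [Matrix.single_mul_single_same, Matrix.single_mul_single_of_ne _ _ _ _ hab.symm, map_zero,
      one_mul] at this
  have hdiag : ∀ a, f (Matrix.single a a 1) = f (Matrix.single o o 1) := fun a => by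
    have := hf (Matrix.single a o 1) (Matrix.single o a 1)
    rwa [Matrix.single_mul_single_same, Matrix.single_mul_single_same, one_mul] at this
  refine ⟨f (Matrix.single o o 1), fun M => ?_⟩
  conv_lhs => rw [Matrix.matrix_eq_sum_single M]
  have hs : ∀ a b, f (Matrix.single a b (M a b)) = M a b * f (Matrix.single a b 1) := fun a b => by
    rw [← smul_eq_mul, ← map_smul, Matrix.smul_single, smul_eq_mul, mul_one]
  simp only [map_sum, hs, Matrix.trace, Matrix.diag_apply, Finset.mul_sum]
  refine Finset.sum_congr rfl fun a _ => ?_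
  rw [Finset.sum_eq_single a (fun b _ hb => by rw [hoff a b hb.symm, mul_zero]) (by simp), hdiag,
    mul_comm]

/-- A linear functional on a product of matrix algebras which does not see the order of products is
a linear combination of the traces of the factors. -/
theorem Matrix.exists_eq_sum_smul_trace_of_mul_comm {k ι : Type*} [Field k] [Fintype ι]
    [DecidableEq ι] {d : ι → ℕ} (f : (∀ i, Matrix (Fin (d i)) (Fin (d i)) k) →ₗ[k] k)
    (hf : ∀ a b, f (a * b) = f (b * a)) :
    ∃ c : ι → k, ∀ M, f M = ∑ i, c i * (M i).trace := by
  have h : ∀ i, ∃ c : k, ∀ M, f (Pi.single i M) = c * M.trace := fun i => by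
    refine Matrix.exists_eq_smul_trace_of_mul_comm
      (f ∘ₗ LinearMap.single k (fun i => Matrix (Fin (d i)) (Fin (d i)) k) i) fun a b => ?_
    simp only [LinearMap.comp_apply, LinearMap.single_apply, Pi.single_mul, hf]
  choose c hc using h
  refine ⟨c, fun M => ?_⟩
  conv_lhs => rw [← Finset.univ_sum_single M]
  simp only [map_sum, hc]

variable {G : Type*} [Group G] [Finite G]

/-- By Wedderburn, `ℂ[G]` is a product of matrix algebras. The projections are irreducible
representations whose characters are the traces of the factors, and a class function extends
linearly to a functional blind to the order of products, hence to a combination of those traces. -/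
theorem exists_irrChars_trace_form (G : Type*) [Group G] [Finite G] :
    ∃ (n : ℕ) (χ : Fin n → G → ℂ), (∀ i, χ i ∈ irrChars G) ∧
      ∀ f : G → ℂ, (∀ a b, f (a * b) = f (b * a)) → ∃ c : Fin n → ℂ, f = ∑ i, c i • χ i := by
  have := Fintype.ofFinite G
  have : NeZero (Nat.card G : ℂ) := ⟨by exact_mod_cast Nat.card_pos.ne'⟩
  obtain ⟨n, d, hd, ⟨e⟩⟩ :=
    IsSemisimpleRing.exists_algEquiv_pi_matrix_of_isAlgClosed ℂ (MonoidAlgebra ℂ G)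
  let π (i : Fin n) : MonoidAlgebra ℂ G →ₐ[ℂ] Module.End ℂ (Fin (d i) → ℂ) :=
    ((Matrix.toLinAlgEquiv' : _ ≃ₐ[ℂ] _).toAlgHom.comp
      (Pi.evalAlgHom ℂ (fun i => Matrix (Fin (d i)) (Fin (d i)) ℂ) i)).comp e.toAlgHom
  let ρ (i : Fin n) : Representation ℂ G (Fin (d i) → ℂ) :=
    (π i : MonoidAlgebra ℂ G →* _).comp (MonoidAlgebra.of ℂ G)
  have hρ : ∀ i, (ρ i).asAlgebraHom = π i := fun i => by
    exact (MonoidAlgebra.lift ℂ _ G).apply_symm_apply (π i)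
  have hirr : ∀ i, (ρ i).IsIrreducible := fun i => by
    have := hd i
    rw [Representation.irreducible_iff_isSimpleModule_asModule,
      isSimpleModule_iff_toSpanSingleton_surjective]
    refine ⟨(inferInstance : Nontrivial (Fin (d i) → ℂ)), fun v hv w => ?_⟩
    let v' : Fin (d i) → ℂ := v
    let w' : Fin (d i) → ℂ := w
    obtain ⟨j, hj⟩ : ∃ j, v' j ≠ 0 := Function.ne_iff.1 (show v' ≠ 0 from hv)
    -- The rank-one matrix `w e_jᵀ / v_j` sends `v` to `w`, so every nonzero vector generates the
    -- module.
    refine ⟨e.symm (Pi.single i (Matrix.vecMulVec w' (Pi.single j (v' j)⁻¹))), ?_⟩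
    change (ρ i).asAlgebraHom _ v' = w'
    rw [hρ]
    ext l
    simp [π, Matrix.vecMulVec_mulVec, hj]
  refine ⟨n, fun i => (ρ i).character, fun i => ⟨d i, ρ i, hirr i, rfl⟩, fun f hf => ?_⟩
  let L : MonoidAlgebra ℂ G →ₗ[ℂ] ℂ := Finsupp.linearCombination ℂ f ∘ₗ (MonoidAlgebra.coeffLinearEquiv ℂ).toLinearMap
  have hL : ∀ g, L (MonoidAlgebra.of ℂ G g) = f g := fun g => by simp [L]
  have hcomm : ∀ a b, L (a * b) = L (b * a) := fun a b => by
    induction a using MonoidAlgebra.induction_on with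
    | of x =>
      induction b using MonoidAlgebra.induction_on with
      | of y => rw [← map_mul, ← map_mul, hL, hL, hf]
      | add y z hy hz => simp only [mul_add, add_mul, map_add, hy, hz]
      | smul r y hy => simp only [mul_smul_comm, smul_mul_assoc, map_smul, hy]
    | add y z hy hz => simp only [mul_add, add_mul, map_add, hy, hz]
    | smul r y hy => simp only [mul_smul_comm, smul_mul_assoc, map_smul, hy]
  obtain ⟨c, hc⟩ := Matrix.exists_eq_sum_smul_trace_of_mul_comm (L ∘ₗ e.symm.toLinearMap)
    fun a b => by simp [hcomm]
  refine ⟨c, funext fun g => ?_⟩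
  have := hc (e (MonoidAlgebra.of ℂ G g))
  rw [LinearMap.comp_apply, AlgEquiv.toLinearMap_apply, AlgEquiv.symm_apply_apply, hL] at this
  rw [this, Finset.sum_apply]
  refine Finset.sum_congr rfl fun i _ => ?_
  congr 1
  exact (Matrix.trace_toLin'_eq _).symm

-- Schur orthogonality with equality of functions replacing isomorphism of representations, as
-- `irrChars` is a set of functions.
open scoped Classical in
theorem irrChars_orthonormal [Fintype G] {φ ψ : G → ℂ} (hφ : φ ∈ irrChars G)
    (hψ : ψ ∈ irrChars G) :
    (Nat.card G : ℂ)⁻¹ * ∑ g, φ g * ψ g⁻¹ = if φ = ψ then 1 else 0 := by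
  have : Invertible (Nat.card G : ℂ) :=
    invertibleOfNonzero (by exact_mod_cast Nat.card_pos.ne')
  obtain ⟨n, ρ, hρ, rfl⟩ := hφ
  obtain ⟨m, σ, hσ, rfl⟩ := hψ
  by_cases h : ρ.character = σ.character
  · rw [if_pos h, ← h, Representation.char_orthonormal, if_pos ⟨Representation.Equiv.refl ρ⟩]
  · rw [if_neg h, Representation.char_orthonormal, if_neg]
    rintro ⟨e⟩
    exact h (Representation.char_iso e).symm

/-- An irreducible character outside the Wedderburn list would be a combination of characters
orthogonal to it, so its norm would be 0 and not 1. -/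
theorem irrChars_finite (G : Type*) [Group G] [Finite G] : (irrChars G).Finite := by
  classical
  have := Fintype.ofFinite G
  obtain ⟨n, χ, hχ, hspan⟩ := exists_irrChars_trace_form G
  refine (Set.finite_range χ).subset fun ψ hψ => ?_
  by_contra hne
  obtain ⟨c, hc⟩ := hspan ψ (by
    obtain ⟨m, ρ, -, rfl⟩ := hψ
    exact fun a b => ρ.char_mul_comm b a)
  have h1 := irrChars_orthonormal hψ hψ
  have h0 : ∑ g, ψ g * ψ g⁻¹ = 0 := by
    have : ∀ g, ψ g * ψ g⁻¹ = ∑ i, c i * (χ i g * ψ g⁻¹) := fun g => by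
      have := congrFun hc g
      simp only [Finset.sum_apply, Pi.smul_apply, smul_eq_mul] at this
      rw [this, Finset.sum_mul]
      simp only [mul_assoc]
    simp only [this]
    rw [Finset.sum_comm]
    refine Finset.sum_eq_zero fun i _ => ?_
    have h := irrChars_orthonormal (hχ i) hψ
    rw [if_neg fun h => hne ⟨i, h⟩] at h
    rw [← Finset.mul_sum, (mul_eq_zero.1 h).resolve_left
      (inv_ne_zero (by exact_mod_cast Nat.card_pos.ne')), mul_zero]
  rw [h0, mul_zero, if_pos rfl] at h1
  exact zero_ne_one h1

/-- The indicator of the identity is a class function, and orthonormality gives its coefficient at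
`ψ` as `ψ(1)/|G|`. -/
theorem sum_irrChars_apply_one_mul (s : Finset (G → ℂ)) (hs : (s : Set (G → ℂ)) = irrChars G)
    (g : G) [Decidable (g = 1)] :
    ∑ ψ ∈ s, ψ 1 * ψ g = if g = 1 then (Nat.card G : ℂ) else 0 := by
  classical
  have := Fintype.ofFinite G
  have hmem : ∀ ψ, ψ ∈ s ↔ ψ ∈ irrChars G := fun ψ => by rw [← hs, Finset.mem_coe]
  have hG : (Nat.card G : ℂ) ≠ 0 := by exact_mod_cast Nat.card_pos.ne'
  obtain ⟨n, χ, hχ, hspan⟩ := exists_irrChars_trace_form G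
  let δ : G → ℂ := fun g => if g = 1 then 1 else 0
  have hδ : δ ∈ Submodule.span ℂ (s : Set (G → ℂ)) := by
    obtain ⟨c, hc⟩ := hspan δ fun a b => by
      have : a * b = 1 ↔ b * a = 1 := mul_eq_one_comm
      simp only [δ, this]
    rw [hc]
    exact Submodule.sum_mem _ fun i _ =>
      Submodule.smul_mem _ _ (Submodule.subset_span ((hmem _).2 (hχ i)))
  obtain ⟨c, -, hc⟩ := Submodule.mem_span_finset.1 hδ
  have hcψ : ∀ ψ ∈ s, c ψ = (Nat.card G : ℂ)⁻¹ * ψ 1 := fun ψ hψ => by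
    have h1 : ∑ g, δ g * ψ g⁻¹ = ψ 1 := by simp [δ]
    rw [← h1, ← hc]
    simp only [Finset.sum_apply, Pi.smul_apply, smul_eq_mul, Finset.sum_mul, mul_assoc]
    rw [Finset.sum_comm, Finset.mul_sum, Finset.sum_eq_single ψ]
    · rw [← Finset.mul_sum, mul_left_comm, irrChars_orthonormal ((hmem _).1 hψ) ((hmem _).1 hψ),
        if_pos rfl, mul_one]
    · intro φ hφ hne
      rw [← Finset.mul_sum, mul_left_comm, irrChars_orthonormal ((hmem _).1 hφ) ((hmem _).1 hψ),
        if_neg hne, mul_zero]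
    · exact fun h => absurd hψ h
  have := congrArg (fun x => (Nat.card G : ℂ) * x) (congrFun hc g)
  simp only [Finset.sum_apply, Pi.smul_apply, smul_eq_mul, δ, mul_ite, mul_one, mul_zero] at this
  rw [← this, Finset.mul_sum]
  refine Finset.sum_congr rfl fun ψ hψ => ?_
  rw [hcψ ψ hψ, ← mul_assoc, mul_inv_cancel_left₀ hG]

/-- An irreducible character has a kernel in the sense of subgroups, and averaging it over a normal
subgroup either fixes or kills it. -/
theorem exists_ker_of_mem_irrChars {ψ : G → ℂ} (hψ : ψ ∈ irrChars G) :
    ∃ K : Subgroup G, ∀ N : Subgroup G, N.Normal →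
      ((N : Set G) ⊆ charKer ψ ↔ N ≤ K) ∧
      ∀ [Fintype N] (g : G), ∑ n : N, ψ (n * g) =
        open scoped Classical in if (N : Set G) ⊆ charKer ψ then (Nat.card N : ℂ) * ψ g else 0 := by
  classical
  obtain ⟨m, ρ, hρ, rfl⟩ := hψ
  refine ⟨MonoidHom.ker ρ, fun N hN => ?_⟩
  have := Fintype.ofFinite N
  have hcard : (Nat.card N : ℂ) ≠ 0 := by exact_mod_cast Nat.card_pos.ne'
  let T : Module.End ℂ (Fin m → ℂ) := ∑ n : N, ρ n
  have hTρ : ∀ n ∈ N, ρ n * T = T := fun n hn => by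
    simp only [T, Finset.mul_sum, ← map_mul]
    exact Fintype.sum_equiv (Equiv.mulLeft (⟨n, hn⟩ : N)) _ _ fun _ => rfl
  have hcomm : ∀ g, T * ρ g = ρ g * T := fun g => by
    simp only [T, Finset.mul_sum, Finset.sum_mul, ← map_mul]
    refine Fintype.sum_equiv (MulAut.conjNormal (H := N) g⁻¹).toEquiv _ _ fun n => ?_
    simp [mul_assoc]
  -- Normality of `N` makes the sum `T` of `ρ` over `N` commute with `ρ`, so Schur's lemma applies.
  -- Since `ρ n * T = T` for `n ∈ N`, a nonzero `c` forces `ρ` to be trivial on `N`.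
  obtain ⟨c, hc⟩ : ∃ c : ℂ, T = c • 1 := by
    let f : ρ.IntertwiningMap ρ := ⟨T, fun g => hcomm g⟩
    obtain ⟨c, hc⟩ :=
      (Representation.IsIrreducible.algebraMap_intertwiningMap_bijective_of_isAlgClosed (ρ := ρ)).2 f
    refine ⟨c, ?_⟩
    exact (congrArg Representation.IntertwiningMap.toLinearMap hc).symm
  have hne : ρ.character 1 ≠ 0 := by
    have : (Module.finrank ℂ (Fin m → ℂ) : ℂ) ≠ 0 := by
      have := IsSimpleModule.nontrivial (MonoidAlgebra ℂ G) ρ.asModule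
      have : Nontrivial (Fin m → ℂ) := this
      exact_mod_cast Module.finrank_pos.ne'
    rwa [Representation.char_one]
  have hsum : ∀ g, ∑ n : N, ρ.character (n * g) = c * ρ.character g := fun g => by
    have : c • ρ g = ∑ n : N, ρ (n * g) := by
      simp only [map_mul, ← Finset.sum_mul]
      change _ = T * ρ g
      rw [hc, smul_mul_assoc, one_mul]
    rw [Representation.character, ← smul_eq_mul, ← map_smul, this, map_sum]
    rfl
  have hone : (N ≤ MonoidHom.ker ρ) → c = Nat.card N := fun h => by
    have h1 := hsum 1
    have : ∀ n : N, ρ.character (n * 1) = ρ.character 1 := fun n => by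
      rw [mul_one, Representation.character, h n.2, Representation.character, map_one ρ]
    simp only [this, Finset.sum_const, Finset.card_univ, nsmul_eq_mul] at h1
    rw [Nat.card_eq_fintype_card]
    exact (mul_right_cancel₀ hne h1).symm
  have hker : (N : Set G) ⊆ charKer ρ.character ↔ N ≤ MonoidHom.ker ρ := by
    refine ⟨fun h => ?_, fun h n hn => ?_⟩
    · have hc0 : c ≠ 0 := fun h0 => by
        have h1 := hsum 1
        have : ∀ n : N, ρ.character (n * 1) = ρ.character 1 := fun n => by
          rw [mul_one]
          exact h n.2
        simp only [this, Finset.sum_const, Finset.card_univ, nsmul_eq_mul, h0, zero_mul] at h1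
        rw [← Nat.card_eq_fintype_card] at h1
        exact mul_ne_zero hcard hne h1
      intro n hn
      have := hTρ n hn
      rw [hc, mul_smul_comm, mul_one] at this
      exact smul_right_injective _ hc0 this
    · change ρ.character n = ρ.character 1
      rw [Representation.character, h hn, Representation.character, map_one ρ]
  refine ⟨hker, fun g => ?_⟩
  split_ifs with h
  · rw [← hone (hker.1 h), ← hsum]
    congr!
  · have hc0 : c = 0 := by
      by_contra hc0
      refine h (hker.2 fun n hn => ?_)
      have := hTρ n hn
      rw [hc, mul_smul_comm, mul_one] at this
      exact smul_right_injective _ hc0 this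
    rw [← zero_mul (ρ.character g), ← hc0, ← hsum]
    congr!

theorem irrChars_charKer_sup {ψ : G → ℂ} (hψ : ψ ∈ irrChars G) {N M : Subgroup G}
    (hN : N.Normal) (hM : M.Normal) (hNψ : (N : Set G) ⊆ charKer ψ)
    (hMψ : (M : Set G) ⊆ charKer ψ) : ((N ⊔ M : Subgroup G) : Set G) ⊆ charKer ψ := by
  obtain ⟨K, hK⟩ := exists_ker_of_mem_irrChars hψ
  exact ((hK _ inferInstance).1).2 (sup_le ((hK N hN).1.1 hNψ) ((hK M hM).1.1 hMψ))

/-- The character of the regular representation of `G ⧸ N`, inflated to `G`. -/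
theorem finsum_irrChars_apply_one_mul (N : Subgroup G) (hN : N.Normal) (g : G)
    [Decidable (g ∈ N)] :
    ∑ᶠ ψ ∈ {ψ | ψ ∈ irrChars G ∧ (N : Set G) ⊆ charKer ψ}, ψ 1 * ψ g =
      if g ∈ N then (N.index : ℂ) else 0 := by
  classical
  have := Fintype.ofFinite N
  have hcard : (Nat.card N : ℂ) ≠ 0 := by exact_mod_cast Nat.card_pos.ne'
  have hs := (irrChars_finite G).coe_toFinset
  have hset : {ψ | ψ ∈ irrChars G ∧ (N : Set G) ⊆ charKer ψ} =
      ((irrChars_finite G).toFinset.filter fun ψ => (N : Set G) ⊆ charKer ψ : Finset (G → ℂ)) := by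
    ext ψ
    simp
  rw [hset, finsum_mem_coe_finset, Finset.sum_filter]
  apply mul_left_cancel₀ hcard
  -- Summing over the coset `N g` selects the characters trivial on `N` and reduces to the regular
  -- character of `G`.
  have h1 : ∀ ψ ∈ (irrChars_finite G).toFinset,
      (Nat.card N : ℂ) * (if (N : Set G) ⊆ charKer ψ then ψ 1 * ψ g else 0) =
        ∑ n : N, ψ 1 * ψ (n * g) := fun ψ hψ => by
    obtain ⟨K, hK⟩ := exists_ker_of_mem_irrChars ((irrChars_finite G).mem_toFinset.1 hψ)
    rw [← Finset.mul_sum, (hK N hN).2 g]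
    split_ifs <;> ring
  rw [Finset.mul_sum, Finset.sum_congr rfl h1, Finset.sum_comm]
  simp only [sum_irrChars_apply_one_mul _ hs]
  by_cases hg : g ∈ N
  · rw [if_pos hg, Finset.sum_eq_single (⟨g⁻¹, N.inv_mem hg⟩ : N)]
    · rw [if_pos (inv_mul_cancel g)]
      exact_mod_cast N.card_mul_index.symm
    · intro n _ hne
      rw [if_neg]
      exact fun h => hne (Subtype.ext (eq_inv_of_mul_eq_one_left h))
    · simp
  · rw [if_neg hg, mul_zero]
    refine Finset.sum_eq_zero fun n _ => if_neg fun h => hg ?_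
    rw [← inv_eq_of_mul_eq_one_right h]
    exact N.inv_mem n.2

/-- The block attached to `N` consists of the irreducible characters whose kernel contains `N` as
its largest member of the lattice. -/
theorem mem_charBlock_iff {NN : Set (Subgroup G)} (hnormal : ∀ N ∈ NN, N.Normal)
    (hsup : ∀ N ∈ NN, ∀ M ∈ NN, N ⊔ M ∈ NN) {N : Subgroup G} (hN : N ∈ NN) {ψ : G → ℂ} :
    ψ ∈ charBlock NN N ↔ ψ ∈ irrChars G ∧ (N : Set G) ⊆ charKer ψ ∧
      ∀ O ∈ NN, (O : Set G) ⊆ charKer ψ → O ≤ N := by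
  refine ⟨fun ⟨h1, h2, h3⟩ => ⟨h1, h2, fun O hO hOψ => ?_⟩,
    fun ⟨h1, h2, h3⟩ => ⟨h1, h2, fun O hO hOψ => hO.2.1.not_ge (h3 O hO.1 hOψ)⟩⟩
  by_contra hle
  have hlt : N < O ⊔ N := right_lt_sup.2 hle
  -- A minimal member of the lattice strictly above `N` and inside `O ⊔ N` is a cover of `N`, and it
  -- lies in the kernel because `O ⊔ N` does.
  obtain ⟨M, hM⟩ := Set.Finite.exists_minimal
    (s := {M | M ∈ NN ∧ N < M ∧ M ≤ O ⊔ N}) (Set.toFinite _) ⟨O ⊔ N, hsup O hO N hN, hlt, le_rfl⟩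
  refine h3 M ⟨hM.prop.1, hM.prop.2.1, fun M' hM' hNM' hle' => ?_⟩ fun x hx =>
    irrChars_charKer_sup h1 (hnormal O hO) (hnormal N hN) hOψ h2 (hM.prop.2.2 hx)
  exact le_antisymm hle' (hM.le_of_le ⟨hM', hNM', hle'.trans hM.prop.2.2⟩ hle')

end CharacterTheory

/-! ### Lower sets of intervals and antichains -/

section PatternGroups

variable {A : Type*}

/-- Sets of proper intervals closed under passing to smaller proper intervals. -/
def IsLowerPart (R : PartialOrder A) (D : Set (A × A)) : Prop :=
  D ⊆ properInt R ∧ ∀ p ∈ properInt R, ∀ q ∈ D, IntLE R p q → p ∈ D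

/-- The proper intervals contained in some member of `S`. -/
def lowerPart (R : PartialOrder A) (S : Set (A × A)) : Set (A × A) :=
  {p | p ∈ properInt R ∧ ∃ q ∈ S, IntLE R p q}

theorem IntLE.refl (R : PartialOrder A) (p : A × A) : IntLE R p p :=
  ⟨R.le_refl _, R.le_refl _⟩

theorem IntLE.trans {R : PartialOrder A} {p q r : A × A} (h : IntLE R p q) (h' : IntLE R q r) :
    IntLE R p r :=
  ⟨R.le_trans _ _ _ h'.1 h.1, R.le_trans _ _ _ h.2 h'.2⟩

theorem IntLE.antisymm {R : PartialOrder A} {p q : A × A} (h : IntLE R p q) (h' : IntLE R q p) :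
    p = q :=
  Prod.ext (R.le_antisymm _ _ h'.1 h.1) (R.le_antisymm _ _ h.2 h'.2)

theorem isLowerPart_lowerPart (R : PartialOrder A) (S : Set (A × A)) :
    IsLowerPart R (lowerPart R S) :=
  ⟨fun _ hp => hp.1, fun _ hp _ ⟨_, r, hr, hqr⟩ hpq => ⟨hp, r, hr, hpq.trans hqr⟩⟩

theorem subset_lowerPart {R : PartialOrder A} {S : Set (A × A)} (hS : S ⊆ properInt R) :
    S ⊆ lowerPart R S :=
  fun p hp => ⟨hS hp, p, hp, IntLE.refl R p⟩

theorem lowerPart_subset {R : PartialOrder A} {S D : Set (A × A)} (hD : IsLowerPart R D)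
    (h : S ⊆ D) : lowerPart R S ⊆ D :=
  fun p ⟨hp, q, hq, hpq⟩ => hD.2 p hp q (h hq) hpq

theorem IsLowerPart.lowerPart_eq {R : PartialOrder A} {D : Set (A × A)} (hD : IsLowerPart R D) :
    lowerPart R D = D :=
  (lowerPart_subset hD subset_rfl).antisymm (subset_lowerPart hD.1)

theorem IsLowerPart.inter {R : PartialOrder A} {D E : Set (A × A)} (hD : IsLowerPart R D)
    (hE : IsLowerPart R E) : IsLowerPart R (D ∩ E) :=
  ⟨fun _ hp => hD.1 hp.1,
    fun p hp q hq hpq => ⟨hD.2 p hp q hq.1 hpq, hE.2 p hp q hq.2 hpq⟩⟩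

theorem IsLowerPart.union {R : PartialOrder A} {D E : Set (A × A)} (hD : IsLowerPart R D)
    (hE : IsLowerPart R E) : IsLowerPart R (D ∪ E) :=
  ⟨Set.union_subset hD.1 hE.1, fun p hp q hq hpq =>
    hq.imp (fun h => hD.2 p hp q h hpq) fun h => hE.2 p hp q h hpq⟩

theorem IsLowerPart.diff_singleton {R : PartialOrder A} {D : Set (A × A)} (hD : IsLowerPart R D)
    {m : A × A} (hm : ∀ q ∈ D, IntLE R m q → m = q) : IsLowerPart R (D \ {m}) :=
  ⟨fun _ hp => hD.1 hp.1, fun p hp q hq hpq => ⟨hD.2 p hp q hq.1 hpq, by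
    rintro rfl
    exact hq.2 (hm q hq.1 hpq).symm⟩⟩

theorem lowerPart_maximal [Finite A] {R : PartialOrder A} {D : Set (A × A)}
    (hD : IsLowerPart R D) :
    lowerPart R {p | p ∈ D ∧ ∀ q ∈ D, IntLE R p q → p = q} = D := by
  refine (lowerPart_subset hD fun p hp => hp.1).antisymm fun p hp => ⟨hD.1 hp, ?_⟩
  let P : PartialOrder (A × A) :=
    { le := IntLE R
      lt := fun p q => IntLE R p q ∧ ¬ IntLE R q p
      lt_iff_le_not_ge := fun _ _ => Iff.rfl
      le_refl := IntLE.refl R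
      le_trans := fun _ _ _ => IntLE.trans
      le_antisymm := fun _ _ => IntLE.antisymm }
  obtain ⟨m, hpm, hm⟩ := @Set.Finite.exists_le_maximal _ P.toPreorder _ _ (Set.toFinite D) hp
  exact ⟨m, ⟨hm.1, fun q hq hmq => hmq.antisymm (hm.2 hq hmq)⟩, hpm⟩

theorem maximal_mem_nonNesting {R : PartialOrder A} {D : Set (A × A)} (hD : D ⊆ properInt R) :
    {p | p ∈ D ∧ ∀ q ∈ D, IntLE R p q → p = q} ∈ nonNesting R :=
  (mem_nonNesting_iff R _).2
    ⟨fun _ hp => hD hp.1, fun _ hp q hq hne h => hne (hp.2 q hq.1 h)⟩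

theorem eq_of_mem_lowerPart {R : PartialOrder A} {lam : Set (A × A)} (hlam : lam ∈ nonNesting R)
    {p q : A × A} (hp : p ∈ lam) (hq : q ∈ lowerPart R lam) (h : IntLE R p q) : p = q := by
  obtain ⟨-, r, hr, hqr⟩ := hq
  have := hlam.2.eq hp hr (h.trans hqr)
  subst this
  exact h.antisymm hqr

/-- An antichain is recovered from the lower set it generates as its set of maximal elements. -/
theorem lowerPart_injOn (R : PartialOrder A) : Set.InjOn (lowerPart R) (nonNesting R) := by
  have key : ∀ S ∈ nonNesting R, ∀ T ∈ nonNesting R, lowerPart R S = lowerPart R T → S ⊆ T := by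
    intro S hS T hT h p hp
    have hp' := subset_lowerPart hS.1.1 hp
    obtain ⟨hpR, q, hq, hpq⟩ := h ▸ hp'
    have hq' : q ∈ lowerPart R S := h ▸ subset_lowerPart hT.1.1 hq
    rwa [eq_of_mem_lowerPart hS hp hq' hpq]
  exact fun S hS T hT h => (key S hS T hT h).antisymm (key T hT S hS h.symm)

/-- A lower set of proper intervals can be removed from a partial order. -/
theorem IsLowerPart.exists_removed {D : Set (A × A)} (hD : IsLowerPart R D) :
    ∃ P : PartialOrder A, IsSubposet P R ∧ (∀ k l, P.lt k l ↔ R.lt k l ∧ (k, l) ∉ D) := by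
  refine ⟨{ le := fun k l => k = l ∨ (R.lt k l ∧ (k, l) ∉ D)
            lt := fun k l => R.lt k l ∧ (k, l) ∉ D
            le_refl := fun _ => Or.inl rfl
            le_trans := ?_
            lt_iff_le_not_ge := ?_
            le_antisymm := ?_ }, ?_, fun _ _ => Iff.rfl⟩
  · rintro k l m (rfl | ⟨h1, h2⟩) (rfl | ⟨h3, h4⟩)
    · exact Or.inl rfl
    · exact Or.inr ⟨h3, h4⟩
    · exact Or.inr ⟨h1, h2⟩
    · exact Or.inr ⟨@lt_trans A R.toPreorder _ _ _ h1 h3, fun h => h2 (hD.2 _ h1 _ h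
        ⟨R.le_refl _, @le_of_lt A R.toPreorder _ _ h3⟩)⟩
  · intro k l
    constructor
    · intro h
      refine ⟨Or.inr h, ?_⟩
      rintro (rfl | h')
      · exact absurd h.1 (@lt_irrefl A R.toPreorder _)
      · exact absurd h.1 (@lt_asymm A R.toPreorder _ _ h'.1)
    · rintro ⟨rfl | h, h'⟩
      · exact absurd (Or.inl rfl) h'
      · exact h
  · rintro k l (rfl | ⟨h1, -⟩) (h | ⟨h3, -⟩)
    · rfl
    · rfl
    · exact h.symm
    · exact absurd h3 (@lt_asymm A R.toPreorder _ _ h1)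
  · rintro k l (rfl | h)
    · exact R.le_refl _
    · exact @le_of_lt A R.toPreorder _ _ h.1

/-! ### Normal pattern subgroups as vanishing conditions on lower sets -/

variable [Fintype A] [DecidableEq A] {F : Type*} [Field F] [Finite F] {R : PartialOrder A}

/-- `removeBelow R q` drops exactly the intervals inside `q`, so intersecting over `S` imposes zeros
on the lower set generated by `S`. -/
theorem mem_lowerUT_iff {S : Set (A × A)} {u : Matrix.GeneralLinearGroup A F} :
    u ∈ lowerUT F R S ↔ u ∈ UT F R ∧ ∀ p ∈ lowerPart R S, u.val p.1 p.2 = 0 := by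
  rw [lowerUT, Subgroup.mem_inf]
  simp only [Subgroup.mem_iInf]
  refine and_congr_right fun hu => ⟨?_, ?_⟩
  · rintro h ⟨k, l⟩ ⟨hp, q, hq, hpq⟩
    refine (h q hq).2 k l ?_
    rintro (rfl | h')
    · exact @lt_irrefl A R.toPreorder _ hp
    · exact h'.2 hpq
  · refine fun h q hq => ⟨hu.1, fun k l hkl => ?_⟩
    by_cases hle : R.le k l
    · have hne : k ≠ l := fun e => hkl (Or.inl e)
      have hlt : R.lt k l := @lt_of_le_of_ne A R _ _ hle hne
      exact h (k, l) ⟨hlt, q, hq, not_not.1 fun h' => hkl (Or.inr ⟨hlt, h'⟩)⟩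
    · exact hu.2 k l hle

theorem lowerUT_lowerPart (S : Set (A × A)) : lowerUT F R (lowerPart R S) = lowerUT F R S := by
  ext u
  rw [mem_lowerUT_iff, mem_lowerUT_iff, (isLowerPart_lowerPart R S).lowerPart_eq]

theorem IsLowerPart.mem_lowerUT_iff {D : Set (A × A)} (hD : IsLowerPart R D)
    {u : Matrix.GeneralLinearGroup A F} :
    u ∈ lowerUT F R D ↔ u ∈ UT F R ∧ ∀ p ∈ D, u.val p.1 p.2 = 0 := by
  rw [_root_.mem_lowerUT_iff, hD.lowerPart_eq]

theorem lowerUT_le (S : Set (A × A)) : lowerUT F R S ≤ UT F R :=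
  inf_le_left

theorem lowerUT_eq_UT {D : Set (A × A)} (hD : IsLowerPart R D) {P : PartialOrder A}
    (hPR : IsSubposet P R) (hP : ∀ k l, P.lt k l ↔ R.lt k l ∧ (k, l) ∉ D) :
    lowerUT F R D = UT F P := by
  ext u
  rw [hD.mem_lowerUT_iff]
  constructor
  · rintro ⟨hu, h⟩
    refine ⟨hu.1, fun k l hkl => ?_⟩
    by_cases hle : R.le k l
    · have hne : k ≠ l := fun e => hkl (e ▸ P.le_refl k)
      have hlt : R.lt k l := @lt_of_le_of_ne A R _ _ hle hne
      refine h (k, l) (not_not.1 fun h' => hkl (@le_of_lt A P.toPreorder _ _ ((hP k l).2 ⟨hlt, h'⟩)))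
    · exact hu.2 k l hle
  · intro hu
    refine ⟨UT_mono F hPR hu, fun p hp => hu.2 _ _ fun hle => ?_⟩
    have hne : p.1 ≠ p.2 := fun e => by
      have : R.lt p.1 p.2 := hD.1 hp
      rw [e] at this
      exact @lt_irrefl A R.toPreorder _ this
    exact ((hP p.1 p.2).1 (@lt_of_le_of_ne A P _ _ hle hne)).2 hp

/-- The order of a pattern group. -/
theorem card_UT (R : PartialOrder A) :
    Nat.card (UT F R) = Nat.card F ^ (properInt R).ncard := by
  classical
  have e : (UT F R) ≃ (properInt R → F) := by
    refine Equiv.ofBijective (fun u p => u.1.val p.1.1 p.1.2) ⟨fun u v h => ?_, fun f => ?_⟩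
    · refine Subtype.ext (Units.ext (Matrix.ext fun i j => ?_))
      by_cases hij : i = j
      · subst hij
        rw [u.2.1, v.2.1]
      · by_cases hle : R.le i j
        · exact congrFun h ⟨(i, j), @lt_of_le_of_ne A R _ _ hle hij⟩
        · rw [u.2.2 i j hle, v.2.2 i j hle]
    · obtain ⟨u, hu, he⟩ := exists_mem_UT (R := R)
        (fun i j => if i = j then 1 else if h : (i, j) ∈ properInt R then f ⟨(i, j), h⟩ else 0)
        (fun i => if_pos rfl) fun i j hij => by
          rw [if_neg fun e : i = j => hij (e ▸ R.le_refl i),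
            dif_neg fun h : (i, j) ∈ properInt R => hij (@le_of_lt A R.toPreorder _ _ h)]
      refine ⟨⟨u, hu⟩, funext fun p => ?_⟩
      change u.val p.1.1 p.1.2 = f p
      have hne : p.1.1 ≠ p.1.2 := @ne_of_lt A R.toPreorder _ _ p.2
      rw [he]
      exact (if_neg hne).trans (dif_pos p.2)
  rw [Nat.card_congr e, Nat.card_fun, Nat.card_coe_set_eq]

theorem card_lowerUT_mul {D : Set (A × A)} (hD : IsLowerPart R D) :
    Nat.card (lowerUT F R D) * Nat.card F ^ D.ncard = Nat.card F ^ (properInt R).ncard := by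
  obtain ⟨P, hPR, hP⟩ := hD.exists_removed
  have : properInt P = properInt R \ D := Set.ext fun p => hP p.1 p.2
  rw [lowerUT_eq_UT hD hPR hP, card_UT, this, ← pow_add,
    Set.ncard_sdiff_add_ncard_of_subset hD.1]

theorem index_lowerUT {D : Set (A × A)} (hD : IsLowerPart R D) :
    ((lowerUT F R D).subgroupOf (UT F R)).index = Nat.card F ^ D.ncard := by
  have h := ((lowerUT F R D).subgroupOf (UT F R)).card_mul_index
  rw [Nat.card_congr (Subgroup.subgroupOfEquivOfLe (lowerUT_le D)).toEquiv, card_UT,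
    ← card_lowerUT_mul hD] at h
  exact Nat.eq_of_mul_eq_mul_left Nat.card_pos h

/-- In `u x u⁻¹ = 1 + u (x - 1) u⁻¹`, the entry at `(i, j)` only involves entries of `x - 1` at `(k,
l)` with `i ≼ k` and `l ≼ j`. These are zero when `[i, j] ∈ D`, as `D` is a lower set. -/
theorem lowerUT_normal {D : Set (A × A)} (hD : IsLowerPart R D) :
    ((lowerUT F R D).subgroupOf (UT F R)).Normal := by
  refine ⟨fun x hx u => ?_⟩
  rw [Subgroup.mem_subgroupOf, hD.mem_lowerUT_iff] at hx ⊢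
  refine ⟨(u * x * u⁻¹).2, ?_⟩
  rintro ⟨i, j⟩ hp
  have hlt : R.lt i j := hD.1 hp
  have hne : i ≠ j := @ne_of_lt A R.toPreorder _ _ hlt
  let U : Matrix A A F := u.1.val
  let V : Matrix A A F := (u⁻¹).1.val
  let X : Matrix A A F := x.1.val
  have hUV : U * V = 1 := congrArg (fun g : UT F R => g.1.val) (mul_inv_cancel u)
  have hsplit : (u * x * u⁻¹).1.val = 1 + U * (X - 1) * V := by
    rw [mul_sub, sub_mul, mul_one, hUV, add_sub_cancel]
    rfl
  change (u * x * u⁻¹).1.val i j = 0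
  rw [hsplit, Matrix.add_apply, Matrix.one_apply_ne hne, zero_add, Matrix.mul_apply]
  refine Finset.sum_eq_zero fun l _ => ?_
  by_cases hlj : R.le l j
  swap
  · rw [show V l j = 0 from (u⁻¹).2.2 l j hlj, mul_zero]
  rw [Matrix.mul_apply, Finset.sum_eq_zero, zero_mul]
  intro k _
  by_cases hik : R.le i k
  swap
  · rw [show U i k = 0 from u.2.2 i k hik, zero_mul]
  have : (X - 1) k l = 0 := by
    rw [Matrix.sub_apply]
    by_cases hkl : k = l
    · subst hkl
      rw [show X k k = 1 from x.2.1 k, Matrix.one_apply_eq, sub_self]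
    · rw [Matrix.one_apply_ne hkl, sub_zero]
      by_cases hle : R.le k l
      · exact hx.2 (k, l) (hD.2 _ (@lt_of_le_of_ne A R _ _ hle hkl) _ hp ⟨hik, hlj⟩)
      · exact x.2.2 k l hle
  rw [this, mul_zero]

theorem exists_transvection_mem_UT {p : A × A} (hp : p ∈ properInt R) :
    ∃ u ∈ UT F R, u.val = 1 + Matrix.single p.1 p.2 1 := by
  have hne : p.1 ≠ p.2 := @ne_of_lt A R.toPreorder _ _ hp
  refine exists_mem_UT _ (fun i => ?_) fun i j hij => ?_
  · rw [Matrix.add_apply, Matrix.one_apply_eq, Matrix.single_apply_of_ne, add_zero]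
    rintro ⟨rfl, h⟩
    exact hne h.symm
  · rw [Matrix.add_apply, Matrix.one_apply_ne fun e : i = j => hij (e ▸ R.le_refl i),
      Matrix.single_apply_of_ne, add_zero]
    rintro ⟨rfl, rfl⟩
    exact hij (@le_of_lt A R.toPreorder _ _ hp)

/-- A position in `E` but not in `D` carries an elementary matrix that vanishes on `D` and not on
`E`. -/
theorem lowerUT_le_lowerUT_iff {D E : Set (A × A)} (hD : IsLowerPart R D) (hE : IsLowerPart R E) :
    lowerUT F R D ≤ lowerUT F R E ↔ E ⊆ D := by
  refine ⟨fun h p hp => ?_, fun h u hu => ?_⟩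
  · by_contra hpD
    obtain ⟨u, hu, he⟩ := exists_transvection_mem_UT (F := F) (hE.1 hp)
    have hne : ∀ q ∈ properInt R, q.1 ≠ q.2 := fun q hq => @ne_of_lt A R.toPreorder _ _ hq
    have huD : u ∈ lowerUT F R D := by
      refine hD.mem_lowerUT_iff.2 ⟨hu, fun q hq => ?_⟩
      rw [he, Matrix.add_apply, Matrix.one_apply_ne (hne q (hD.1 hq)),
        Matrix.single_apply_of_ne, add_zero]
      rintro ⟨h1, h2⟩
      exact hpD (Prod.ext h1 h2 ▸ hq)
    have := (hE.mem_lowerUT_iff.1 (h huD)).2 p hp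
    rw [he, Matrix.add_apply, Matrix.one_apply_ne (hne p (hE.1 hp)),
      Matrix.single_apply_same, zero_add] at this
    exact one_ne_zero this
  · rw [hD.mem_lowerUT_iff] at hu
    exact hE.mem_lowerUT_iff.2 ⟨hu.1, fun p hp => hu.2 p (h hp)⟩

theorem lowerUT_inf_lowerUT {D E : Set (A × A)} (hD : IsLowerPart R D) (hE : IsLowerPart R E) :
    lowerUT F R D ⊓ lowerUT F R E = lowerUT F R (D ∪ E) := by
  ext u
  rw [Subgroup.mem_inf, hD.mem_lowerUT_iff, hE.mem_lowerUT_iff, (hD.union hE).mem_lowerUT_iff]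
  simp only [Set.mem_union, or_imp, forall_and]
  tauto

/-- One inclusion is clear; the indices then agree by the second isomorphism theorem and `|D ∪ E| +
|D ∩ E| = |D| + |E|`. -/
theorem lowerUT_sup_lowerUT {D E : Set (A × A)} (hD : IsLowerPart R D) (hE : IsLowerPart R E) :
    (lowerUT F R D).subgroupOf (UT F R) ⊔ (lowerUT F R E).subgroupOf (UT F R) =
      (lowerUT F R (D ∩ E)).subgroupOf (UT F R) := by
  have hle : (lowerUT F R D).subgroupOf (UT F R) ⊔ (lowerUT F R E).subgroupOf (UT F R) ≤
      (lowerUT F R (D ∩ E)).subgroupOf (UT F R) :=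
    sup_le
      (Subgroup.comap_mono ((lowerUT_le_lowerUT_iff hD (hD.inter hE)).2 Set.inter_subset_left))
      (Subgroup.comap_mono ((lowerUT_le_lowerUT_iff hE (hD.inter hE)).2 Set.inter_subset_right))
  have hq : 0 < Nat.card F := Nat.card_pos
  have hN := lowerUT_normal (F := F) hE
  have hinf : (lowerUT F R D).subgroupOf (UT F R) ⊓ (lowerUT F R E).subgroupOf (UT F R) =
      (lowerUT F R (D ∪ E)).subgroupOf (UT F R) := by
    rw [← lowerUT_inf_lowerUT hD hE]
    rfl
  have h1 := Subgroup.relIndex_mul_index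
    (inf_le_left : (lowerUT F R D).subgroupOf (UT F R) ⊓ (lowerUT F R E).subgroupOf (UT F R) ≤ _)
  have h2 := Subgroup.relIndex_mul_index
    (le_sup_right : (lowerUT F R E).subgroupOf (UT F R) ≤ (lowerUT F R D).subgroupOf (UT F R) ⊔ _)
  rw [Subgroup.inf_relIndex_left, hinf, index_lowerUT hD, index_lowerUT (hD.union hE)] at h1
  rw [Subgroup.relIndex_sup_right, index_lowerUT hE] at h2
  have h3 := congrArg (Nat.card F ^ ·) (Set.ncard_union_add_ncard_inter D E)
  simp only [pow_add] at h3
  have hidx : ((lowerUT F R D).subgroupOf (UT F R) ⊔ (lowerUT F R E).subgroupOf (UT F R)).index =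
      ((lowerUT F R (D ∩ E)).subgroupOf (UT F R)).index := by
    rw [index_lowerUT (hD.inter hE)]
    apply Nat.eq_of_mul_eq_mul_left (pow_pos hq (D ∪ E).ncard)
    rw [h3, ← h1, ← h2]
    ring
  refine Subgroup.eq_of_le_of_card_ge hle (le_of_eq ?_)
  refine Nat.eq_of_mul_eq_mul_right (Nat.pos_of_ne_zero Subgroup.index_ne_zero_of_finite)
    ((Subgroup.card_mul_index _).trans ?_)
  rw [← hidx, Subgroup.card_mul_index]

/-- Conjugating `1 + E_kl` by `1 + E_ik` creates a nonzero entry at `(i, l)`. -/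
theorem lt_of_UT_normal_of_lt_left {P : PartialOrder A} (hPR : IsSubposet P R)
    (hN : ((UT F P).subgroupOf (UT F R)).Normal) {i k l : A} (hik : R.lt i k) (hkl : P.lt k l) :
    P.lt i l := by
  have hkl' : R.lt k l := @lt_of_le_of_ne A R _ _ (hPR _ _ (@le_of_lt A P.toPreorder _ _ hkl))
    (@ne_of_lt A P.toPreorder _ _ hkl)
  have nik := @ne_of_lt A R.toPreorder _ _ hik
  have nkl := @ne_of_lt A R.toPreorder _ _ hkl'
  have nil := @ne_of_lt A R.toPreorder _ _ (@lt_trans A R.toPreorder _ _ _ hik hkl')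
  obtain ⟨u, hu, hue⟩ := exists_transvection_mem_UT (F := F) (R := R) (p := (i, k)) hik
  obtain ⟨x, hx, hxe⟩ := exists_transvection_mem_UT (F := F) (R := P) (p := (k, l)) hkl
  have hy : u * x * u⁻¹ ∈ UT F P := hN.conj_mem ⟨x, UT_mono F hPR hx⟩ hx ⟨u, hu⟩
  by_contra h
  have h0 := hy.2 i l fun hle => h (@lt_of_le_of_ne A P _ _ hle nil)
  -- Comparing entries of `y u = u x` avoids computing `u⁻¹`.
  have hyu : (u * x * u⁻¹).val * u.val = u.val * x.val := by
    rw [← Units.val_mul, inv_mul_cancel_right, Units.val_mul]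
  generalize u * x * u⁻¹ = y at *
  have := congrFun (congrFun hyu i) l
  rw [hue, hxe] at this
  simp [mul_add, add_mul, h0, nkl, nil, nkl.symm, nik.symm] at this

theorem lt_of_UT_normal_of_lt_right {P : PartialOrder A} (hPR : IsSubposet P R)
    (hN : ((UT F P).subgroupOf (UT F R)).Normal) {k l j : A} (hkl : P.lt k l) (hlj : R.lt l j) :
    P.lt k j := by
  have hkl' : R.lt k l := @lt_of_le_of_ne A R _ _ (hPR _ _ (@le_of_lt A P.toPreorder _ _ hkl))
    (@ne_of_lt A P.toPreorder _ _ hkl)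
  have nlj := @ne_of_lt A R.toPreorder _ _ hlj
  have nkl := @ne_of_lt A R.toPreorder _ _ hkl'
  have nkj := @ne_of_lt A R.toPreorder _ _ (@lt_trans A R.toPreorder _ _ _ hkl' hlj)
  obtain ⟨u, hu, hue⟩ := exists_transvection_mem_UT (F := F) (R := R) (p := (l, j)) hlj
  obtain ⟨x, hx, hxe⟩ := exists_transvection_mem_UT (F := F) (R := P) (p := (k, l)) hkl
  have hy : u * x * u⁻¹ ∈ UT F P := hN.conj_mem ⟨x, UT_mono F hPR hx⟩ hx ⟨u, hu⟩
  by_contra h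
  have h0 := hy.2 k j fun hle => h (@lt_of_le_of_ne A P _ _ hle nkj)
  have hyu : (u * x * u⁻¹).val * u.val = u.val * x.val := by
    rw [← Units.val_mul, inv_mul_cancel_right, Units.val_mul]
  generalize u * x * u⁻¹ = y at *
  have h1 := congrFun (congrFun hyu k) l
  have h2 := congrFun (congrFun hyu k) j
  rw [hue, hxe] at h1 h2
  -- The entry at `(k, l)` gives `y_kl = 1`; the one at `(k, j)` then reads `y_kj + y_kl = 0`,
  -- against `y_kj = 0`.
  simp [mul_add, add_mul, nkl, nlj, nkl.symm, nlj.symm] at h1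
  simp [mul_add, add_mul, h0, h1, nkj, nlj, nkl.symm, nkj.symm] at h2

/-- Normality closes the intervals of `P` under enlargement in `R` at either end, so the missing
intervals form a lower set. -/
theorem UT_mem_NPtt_iff {N : Subgroup (UT F R)} :
    N ∈ NPtt F R ↔ ∃ D, IsLowerPart R D ∧ N = (lowerUT F R D).subgroupOf (UT F R) := by
  constructor
  · rintro ⟨hN, P, hPR, rfl⟩
    have hlt : ∀ {i j}, P.lt i j → R.lt i j := fun h => @lt_of_le_of_ne A R _ _
      (hPR _ _ (@le_of_lt A P.toPreorder _ _ h)) (@ne_of_lt A P.toPreorder _ _ h)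
    have hD : IsLowerPart R (properInt R \ properInt P) := by
      refine ⟨Set.sdiff_subset, fun p hp q hq hpq => ⟨hp, fun hpP => hq.2 ?_⟩⟩
      have h1 : P.lt q.1 p.2 := by
        rcases eq_or_ne q.1 p.1 with e | e
        · rw [e]
          exact hpP
        · exact lt_of_UT_normal_of_lt_left hPR hN (@lt_of_le_of_ne A R _ _ hpq.1 e) hpP
      change P.lt q.1 q.2
      rcases eq_or_ne p.2 q.2 with e | e
      · rwa [← e]
      · exact lt_of_UT_normal_of_lt_right hPR hN h1 (@lt_of_le_of_ne A R _ _ hpq.2 e)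
    refine ⟨_, hD, ?_⟩
    rw [lowerUT_eq_UT hD hPR fun k l => ⟨fun h => ⟨hlt h, fun h' => h'.2 h⟩,
      fun h => not_not.1 fun h' => h.2 ⟨h.1, h'⟩⟩]
  · rintro ⟨D, hD, rfl⟩
    obtain ⟨P, hPR, hP⟩ := hD.exists_removed
    exact ⟨lowerUT_normal hD, P, hPR, by rw [lowerUT_eq_UT hD hPR hP]⟩

end PatternGroups

/-! ### Explicit values of the supercharacters -/

section PatternSupercharacters

variable {A : Type*} [Fintype A] [DecidableEq A]

/-- The irreducible characters of `UT_R` which are trivial on the pattern subgroup vanishing on `D`,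
but not on the pattern subgroup vanishing on `D \ {m}` for any `m ∈ M`. -/
def partBlock (F : Type*) [Field F] [Finite F] (R : PartialOrder A) (D : Set (A × A))
    (M : Finset (A × A)) : Set (UT F R → ℂ) :=
  {ψ | ψ ∈ irrChars (UT F R) ∧
    (((lowerUT F R D).subgroupOf (UT F R) : Subgroup (UT F R)) : Set (UT F R)) ⊆ charKer ψ ∧
    ∀ m ∈ M, ¬ (((lowerUT F R (D \ {m})).subgroupOf (UT F R) : Subgroup (UT F R)) :
      Set (UT F R)) ⊆ charKer ψ}

variable {F : Type*} [Field F] [Finite F] {R : PartialOrder A}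

theorem subgroupOf_lowerUT_mono {D E : Set (A × A)} (hD : IsLowerPart R D) (hE : IsLowerPart R E)
    (h : E ⊆ D) :
    (lowerUT F R D).subgroupOf (UT F R) ≤ (lowerUT F R E).subgroupOf (UT F R) :=
  Subgroup.comap_mono ((lowerUT_le_lowerUT_iff hD hE).2 h)

theorem charKer_lowerUT_inter {ψ : UT F R → ℂ} (hψ : ψ ∈ irrChars (UT F R)) {D E : Set (A × A)}
    (hD : IsLowerPart R D) (hE : IsLowerPart R E)
    (hDψ : (((lowerUT F R D).subgroupOf (UT F R) : Subgroup (UT F R)) : Set (UT F R)) ⊆ charKer ψ)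
    (hEψ : (((lowerUT F R E).subgroupOf (UT F R) : Subgroup (UT F R)) : Set (UT F R)) ⊆
      charKer ψ) :
    (((lowerUT F R (D ∩ E)).subgroupOf (UT F R) : Subgroup (UT F R)) : Set (UT F R)) ⊆
      charKer ψ := by
  rw [← lowerUT_sup_lowerUT hD hE]
  exact irrChars_charKer_sup hψ (lowerUT_normal hD) (lowerUT_normal hE) hDψ hEψ

/-- The block is split by whether `ψ` is trivial on `N_{D \ {p}}`. If it is, then triviality on
`N_{D \ {m}}` and on `N_{D \ {p, m}}` are equivalent, the latter being the join of `N_{D \ {p}}` and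
`N_{D \ {m}}`. -/
theorem partBlock_eq_union {D : Set (A × A)} (hD : IsLowerPart R D) {M : Finset (A × A)}
    {p : A × A} (hpM : p ∉ M)
    (hM : ∀ m ∈ insert p M, m ∈ D ∧ ∀ q ∈ D, IntLE R m q → m = q) :
    partBlock F R D M = partBlock F R D (insert p M) ∪ partBlock F R (D \ {p}) M ∧
      Disjoint (partBlock F R D (insert p M)) (partBlock F R (D \ {p}) M) := by
  have hDp := hD.diff_singleton (hM p (Finset.mem_insert_self p M)).2
  have hm : ∀ m ∈ M, IsLowerPart R (D \ {m}) := fun m hm =>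
    hD.diff_singleton (hM m (Finset.mem_insert_of_mem hm)).2
  have hinter : ∀ m ∈ M, (D \ {p}) ∩ (D \ {m}) = (D \ {p}) \ {m} := fun m _ => by
    ext x
    simp only [Set.mem_inter_iff, Set.mem_sdiff]
    tauto
  have hpm : ∀ m ∈ M, IsLowerPart R ((D \ {p}) \ {m}) := fun m h => hinter m h ▸ hDp.inter (hm m h)
  refine ⟨Set.Subset.antisymm ?_ (Set.union_subset ?_ ?_), ?_⟩
  · rintro ψ ⟨h1, h2, h3⟩
    by_cases h : (((lowerUT F R (D \ {p})).subgroupOf (UT F R) : Subgroup (UT F R)) :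
        Set (UT F R)) ⊆ charKer ψ
    · refine Or.inr ⟨h1, h, fun m hmM hψ => h3 m hmM ?_⟩
      exact subset_trans (subgroupOf_lowerUT_mono (hm m hmM) (hpm m hmM)
        fun x hx => ⟨hx.1.1, hx.2⟩) hψ
    · refine Or.inl ⟨h1, h2, fun m hmM => ?_⟩
      rcases Finset.mem_insert.1 hmM with rfl | hmM
      · exact h
      · exact h3 m hmM
  · rintro ψ ⟨h1, h2, h3⟩
    exact ⟨h1, h2, fun m hmM => h3 m (Finset.mem_insert_of_mem hmM)⟩
  · rintro ψ ⟨h1, h2, h3⟩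
    refine ⟨h1, subset_trans (subgroupOf_lowerUT_mono hD hDp Set.sdiff_subset) h2,
      fun m hmM hψ => h3 m hmM ?_⟩
    rw [← hinter m hmM]
    exact charKer_lowerUT_inter h1 hDp (hm m hmM) h2 hψ
  · exact Set.disjoint_left.2 fun ψ h h' => h.2.2 p (Finset.mem_insert_self p M) h'.2.1

-- Inclusion-exclusion, one element of `M` at a time. `M` may omit maximal elements of `D`; this
-- freedom is needed after restriction to `Q`.
open scoped Classical in
theorem finsum_partBlock (M : Finset (A × A)) :
    ∀ D : Set (A × A), IsLowerPart R D →
      (∀ m ∈ M, m ∈ D ∧ ∀ q ∈ D, IntLE R m q → m = q) → ∀ g : UT F R,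
      ∑ᶠ ψ ∈ partBlock F R D M, ψ 1 * ψ g =
        (Nat.card F : ℂ) ^ D.ncard *
          (if ∀ p ∈ D, p ∉ M → g.1.val p.1 p.2 = 0 then 1 else 0) *
          ∏ m ∈ M, ((if g.1.val m.1 m.2 = 0 then 1 else 0) - (Nat.card F : ℂ)⁻¹) := by
  have hq : (Nat.card F : ℂ) ≠ 0 := by exact_mod_cast Nat.card_pos.ne'
  induction M using Finset.induction_on with
  | empty =>
    intro D hD _ g
    have h := finsum_irrChars_apply_one_mul _ (lowerUT_normal (F := F) hD) g
    have hset : partBlock F R D ∅ = {ψ | ψ ∈ irrChars (UT F R) ∧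
        (((lowerUT F R D).subgroupOf (UT F R) : Subgroup (UT F R)) : Set (UT F R)) ⊆
          charKer ψ} := by
      ext ψ
      simp [partBlock]
    have hmem : g ∈ (lowerUT F R D).subgroupOf (UT F R) ↔ ∀ p ∈ D, g.1.val p.1 p.2 = 0 := by
      rw [Subgroup.mem_subgroupOf, hD.mem_lowerUT_iff]
      exact and_iff_right g.2
    rw [hset, h, index_lowerUT hD]
    simp [hmem]
  | insert p M hpM ih =>
    intro D hD hM g
    obtain ⟨hunion, hdisj⟩ := partBlock_eq_union (F := F) hD hpM hM
    have hM' : ∀ m ∈ M, m ∈ D ∧ ∀ q ∈ D, IntLE R m q → m = q :=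
      fun m hm => hM m (Finset.mem_insert_of_mem hm)
    have hpD := (hM p (Finset.mem_insert_self p M)).1
    have h1 := ih D hD hM' g
    have h2 := ih (D \ {p}) (hD.diff_singleton (hM p (Finset.mem_insert_self p M)).2)
      (fun m hm => ⟨⟨(hM' m hm).1, fun e => hpM (e ▸ hm)⟩, fun q hq => (hM' m hm).2 q hq.1⟩) g
    have hfin : ∀ D M, (partBlock F R D M).Finite := fun D M =>
      (irrChars_finite (UT F R)).subset fun ψ h => h.1
    rw [hunion, finsum_mem_union hdisj (hfin _ _) (hfin _ _), h2] at h1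
    rw [← eq_sub_iff_add_eq] at h1
    rw [h1, Finset.prod_insert hpM]
    have hc : (∀ r ∈ D \ {p}, r ∉ M → g.1.val r.1 r.2 = 0) ↔
        ∀ r ∈ D, r ∉ insert p M → g.1.val r.1 r.2 = 0 := by
      simp only [Set.mem_sdiff, Set.mem_singleton_iff, Finset.mem_insert, not_or]
      exact ⟨fun h r hr hn => h r ⟨hr, hn.1⟩ hn.2, fun h r hr hn => h r hr.1 ⟨hr.2, hn⟩⟩
    have hc' : (∀ r ∈ D, r ∉ M → g.1.val r.1 r.2 = 0) ↔
        (∀ r ∈ D, r ∉ insert p M → g.1.val r.1 r.2 = 0) ∧ g.1.val p.1 p.2 = 0 := by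
      rw [← hc]
      refine ⟨fun h => ⟨fun r hr hn => h r hr.1 hn, h p hpD hpM⟩, fun h r hr hn => ?_⟩
      by_cases e : r = p
      · rw [e]
        exact h.2
      · exact h.1 r ⟨hr, e⟩ hn
    have hcard : (Nat.card F : ℂ) ^ D.ncard = (Nat.card F : ℂ) ^ (D \ {p}).ncard * Nat.card F := by
      rw [← pow_succ, Set.ncard_sdiff_singleton_add_one hpD]
    simp only [hc, hc', hcard]
    -- The new factor comes from `q^|D| [g_p = 0] - q^(|D| - 1) = q^|D| ([g_p = 0] - 1/q)`.
    by_cases ha : ∀ r ∈ D, r ∉ insert p M → g.1.val r.1 r.2 = 0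
    · by_cases hb : g.1.val p.1 p.2 = 0
      · simp only [if_pos ha, if_pos hb, if_pos (And.intro ha hb)]
        field_simp
      · simp only [if_pos ha, if_neg hb, if_neg (fun h : _ ∧ _ => hb h.2)]
        field_simp
    · simp only [if_neg ha, if_neg (fun h : _ ∧ _ => ha h.1)]
      ring

theorem mem_charBlock_NPtt_iff {lam : Set (A × A)} {ψ : UT F R → ℂ} :
    ψ ∈ charBlock (NPtt F R) ((lowerUT F R lam).subgroupOf (UT F R)) ↔
      ψ ∈ irrChars (UT F R) ∧
      (((lowerUT F R (lowerPart R lam)).subgroupOf (UT F R) : Subgroup (UT F R)) :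
        Set (UT F R)) ⊆ charKer ψ ∧
      ∀ E, IsLowerPart R E →
        (((lowerUT F R E).subgroupOf (UT F R) : Subgroup (UT F R)) : Set (UT F R)) ⊆ charKer ψ →
        lowerPart R lam ⊆ E := by
  have hD := isLowerPart_lowerPart R lam
  rw [← lowerUT_lowerPart, mem_charBlock_iff (fun N hN => hN.1)]
  · refine and_congr_right fun _ => and_congr_right fun _ => ⟨fun h E hE hEψ => ?_, fun h O hO => ?_⟩
    · rw [← lowerUT_le_lowerUT_iff (F := F) hE hD]
      exact fun u hu => h _ (UT_mem_NPtt_iff.2 ⟨E, hE, rfl⟩) hEψ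
        (show (⟨u, lowerUT_le E hu⟩ : UT F R) ∈ _ from hu)
    · obtain ⟨E, hE, rfl⟩ := UT_mem_NPtt_iff.1 hO
      exact fun hEψ => subgroupOf_lowerUT_mono hE hD (h E hE hEψ)
  · intro N hN M hM
    obtain ⟨D, hD, rfl⟩ := UT_mem_NPtt_iff.1 hN
    obtain ⟨E, hE, rfl⟩ := UT_mem_NPtt_iff.1 hM
    exact UT_mem_NPtt_iff.2 ⟨_, hD.inter hE, lowerUT_sup_lowerUT hD hE⟩
  · exact UT_mem_NPtt_iff.2 ⟨_, hD, rfl⟩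

/-- If `N_E` lies in the kernel and `E` misses some `m ∈ λ`, then `N_{D ∩ E}` lies in the kernel too
and contains `N_{D \ {m}}`. So testing the sets `D \ {m}` suffices. -/
theorem charBlock_eq_partBlock {lam : Set (A × A)} (hlam : lam ∈ nonNesting R)
    {M : Finset (A × A)} (hM : (M : Set (A × A)) = lam) :
    charBlock (NPtt F R) ((lowerUT F R lam).subgroupOf (UT F R)) =
      partBlock F R (lowerPart R lam) M := by
  have hD := isLowerPart_lowerPart R lam
  have hsub := subset_lowerPart hlam.1.1
  have hmem : ∀ m, m ∈ M ↔ m ∈ lam := fun m => by rw [← hM, Finset.mem_coe]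
  have hDm : ∀ m ∈ M, IsLowerPart R (lowerPart R lam \ {m}) := fun m hm =>
    hD.diff_singleton fun q hq => eq_of_mem_lowerPart hlam ((hmem m).1 hm) hq
  ext ψ
  rw [mem_charBlock_NPtt_iff]
  refine and_congr_right fun h1 => and_congr_right fun h2 =>
    ⟨fun h m hm hψ => (h _ (hDm m hm) hψ (hsub ((hmem m).1 hm))).2 rfl, fun h E hE hEψ => ?_⟩
  refine lowerPart_subset hE fun m hm => by_contra fun hmE => h m ((hmem m).2 hm) ?_
  exact subset_trans (subgroupOf_lowerUT_mono (hDm m ((hmem m).2 hm)) (hD.inter hE)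
    fun x hx => ⟨hx.1, fun e => hmE (e ▸ hx.2)⟩) (charKer_lowerUT_inter h1 hD hE h2 hEψ)

theorem latticeSuperchar_apply {G : Type*} [Group G] [Finite G] (NN : Set (Subgroup G))
    (N : Subgroup G) (g : G) :
    latticeSuperchar NN N g = ∑ᶠ ψ ∈ charBlock NN N, ψ 1 * ψ g := by
  have hfin : (charBlock NN N).Finite := (irrChars_finite G).subset fun ψ h => h.1
  rw [latticeSuperchar, finsum_mem_eq_finite_toFinset_sum _ hfin,
    finsum_mem_eq_finite_toFinset_sum _ hfin, Finset.sum_apply]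
  rfl

open scoped Classical in
theorem superchar_apply {lam : Set (A × A)} (hlam : lam ∈ nonNesting R) {M : Finset (A × A)}
    (hM : (M : Set (A × A)) = lam) (g : UT F R) :
    superchar F R lam g = (Nat.card F : ℂ) ^ (lowerPart R lam).ncard *
      (if ∀ p ∈ lowerPart R lam, p ∉ M → g.1.val p.1 p.2 = 0 then 1 else 0) *
      ∏ m ∈ M, ((if g.1.val m.1 m.2 = 0 then 1 else 0) - (Nat.card F : ℂ)⁻¹) := by
  rw [superchar, latticeSuperchar_apply, charBlock_eq_partBlock hlam hM]
  refine finsum_partBlock M _ (isLowerPart_lowerPart R lam) (fun m hm => ?_) g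
  have hm' : m ∈ lam := hM ▸ hm
  exact ⟨subset_lowerPart hlam.1.1 hm', fun q hq => eq_of_mem_lowerPart hlam hm' hq⟩

theorem superchar_apply_one {lam : Set (A × A)} (hlam : lam ∈ nonNesting R) {M : Finset (A × A)}
    (hM : (M : Set (A × A)) = lam) :
    superchar F R lam 1 = (Nat.card F : ℂ) ^ (lowerPart R lam).ncard *
      (1 - (Nat.card F : ℂ)⁻¹) ^ M.card := by
  have h : ∀ p ∈ properInt R, (1 : UT F R).1.val p.1 p.2 = 0 := fun p hp =>
    Matrix.one_apply_ne (@ne_of_lt A R.toPreorder _ _ hp)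
  have hM' : ∀ m ∈ M, m ∈ properInt R := fun m hm => hlam.1.1 (hM ▸ hm)
  rw [superchar_apply hlam hM, if_pos fun p hp _ => h p hp.1, mul_one,
    Finset.prod_congr rfl fun m hm => by rw [if_pos (h m (hM' m hm))], Finset.prod_const]

/-- The supercharacters attached to the pattern subgroups between those of `lam` and of `D` add up to
the block sum of `D` and `lam`. -/
theorem finsum_superchar_apply {D lam : Set (A × A)} (hD : IsLowerPart R D)
    (hlam : lam ∈ nonNesting R) (hmax : ∀ m ∈ lam, m ∈ D ∧ ∀ q ∈ D, IntLE R m q → m = q)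
    {M : Finset (A × A)} (hM : (M : Set (A × A)) = lam) (g : UT F R) :
    (∑ᶠ nu ∈ {nu : Set (A × A) | nu ∈ nonNesting R ∧ lowerUT F R nu ≤ lowerUT F R lam ∧
        lowerUT F R D ≤ lowerUT F R nu}, superchar F R nu) g =
      ∑ᶠ ψ ∈ partBlock F R D M, ψ 1 * ψ g := by
  set S := {nu : Set (A × A) | nu ∈ nonNesting R ∧ lowerUT F R nu ≤ lowerUT F R lam ∧
        lowerUT F R D ≤ lowerUT F R nu} with hS
  have hmem : ∀ m, m ∈ M ↔ m ∈ lam := fun m => by rw [← hM, Finset.mem_coe]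
  have hSfin : S.Finite := Set.toFinite S
  have hSmem : ∀ nu, nu ∈ S ↔ nu ∈ nonNesting R ∧ lowerPart R lam ⊆ lowerPart R nu ∧
      lowerPart R nu ⊆ D := fun nu => by
    rw [hS, Set.mem_ofPred_eq, ← lowerUT_lowerPart nu, ← lowerUT_lowerPart lam,
      lowerUT_le_lowerUT_iff (isLowerPart_lowerPart R nu) (isLowerPart_lowerPart R lam),
      lowerUT_le_lowerUT_iff hD (isLowerPart_lowerPart R nu)]
  have hDm : ∀ m ∈ M, IsLowerPart R (D \ {m}) := fun m hm =>
    hD.diff_singleton (hmax m ((hmem m).1 hm)).2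
  have hunion : partBlock F R D M =
      ⋃ nu ∈ S, charBlock (NPtt F R) ((lowerUT F R nu).subgroupOf (UT F R)) := by
    ext ψ
    simp only [Set.mem_iUnion, exists_prop, mem_charBlock_NPtt_iff]
    constructor
    · rintro ⟨h1, h2, h3⟩
      -- Lower sets whose pattern subgroup lies in the kernel of `ψ` are closed under intersection,
      -- so a minimal one is least. Its maximal elements form the `ν` whose block contains `ψ`.
      obtain ⟨E, hE⟩ := Set.Finite.exists_minimal (s := {E | IsLowerPart R E ∧
        (((lowerUT F R E).subgroupOf (UT F R) : Subgroup (UT F R)) : Set (UT F R)) ⊆ charKer ψ})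
        (Set.toFinite _) ⟨D, hD, h2⟩
      have hleast : ∀ E', IsLowerPart R E' →
          (((lowerUT F R E').subgroupOf (UT F R) : Subgroup (UT F R)) : Set (UT F R)) ⊆
            charKer ψ → E ⊆ E' := fun E' hE' hψ =>
        (hE.le_of_le ⟨hE.prop.1.inter hE', charKer_lowerUT_inter h1 hE.prop.1 hE' hE.prop.2 hψ⟩
          Set.inter_subset_left).trans Set.inter_subset_right
      have he := lowerPart_maximal hE.prop.1
      refine ⟨_, (hSmem _).2 ⟨maximal_mem_nonNesting hE.prop.1.1, ?_, ?_⟩, h1, ?_, ?_⟩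
      · rw [he]
        refine lowerPart_subset hE.prop.1 fun m hm => by_contra fun hmE => ?_
        refine h3 m ((hmem m).2 hm) (subset_trans
          (subgroupOf_lowerUT_mono (hDm m ((hmem m).2 hm)) hE.prop.1 fun x hx => ?_) hE.prop.2)
        exact ⟨hleast D hD h2 hx, fun e => hmE (e ▸ hx)⟩
      · rw [he]
        exact hleast D hD h2
      · rw [he]
        exact hE.prop.2
      · rw [he]
        exact hleast
    · rintro ⟨nu, hnu, h1, h2, h3⟩
      rw [hSmem] at hnu
      refine ⟨h1, subset_trans (subgroupOf_lowerUT_mono hD (isLowerPart_lowerPart R nu) hnu.2.2) h2,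
        fun m hm hψ => (h3 _ (hDm m hm) hψ ?_).2 rfl⟩
      exact hnu.2.1 (subset_lowerPart hlam.1.1 ((hmem m).1 hm))
  have hdisj : S.PairwiseDisjoint fun nu =>
      charBlock (NPtt F R) ((lowerUT F R nu).subgroupOf (UT F R)) := by
    intro nu hnu nu' hnu' hne
    refine Set.disjoint_left.2 fun ψ h h' => hne ?_
    rw [mem_charBlock_NPtt_iff] at h h'
    exact lowerPart_injOn R hnu.1 hnu'.1
      ((h.2.2 _ (isLowerPart_lowerPart R nu') h'.2.1).antisymm
        (h'.2.2 _ (isLowerPart_lowerPart R nu) h.2.1))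
  rw [hunion, finsum_mem_biUnion hdisj hSfin fun nu _ =>
      (irrChars_finite (UT F R)).subset fun ψ h => h.1,
    finsum_mem_eq_finite_toFinset_sum _ hSfin, finsum_mem_eq_finite_toFinset_sum _ hSfin,
    Finset.sum_apply]
  exact Finset.sum_congr rfl fun nu _ => latticeSuperchar_apply _ _ g

end PatternSupercharacters

/-! ### Restriction from `UT_R` to `UT_Q` -/

section Restriction

theorem properInt_mono {A : Type*} {Q R : PartialOrder A} (hQR : IsSubposet Q R) :
    properInt Q ⊆ properInt R := fun _ hp =>
  @lt_of_le_of_ne A R _ _ (hQR _ _ (@le_of_lt A Q.toPreorder _ _ hp))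
    (@ne_of_lt A Q.toPreorder _ _ hp)

theorem IsLowerPart.restrict {A : Type*} {Q R : PartialOrder A} (hQR : IsSubposet Q R)
    {D : Set (A × A)} (hD : IsLowerPart R D) :
    IsLowerPart Q (D ∩ properInt Q) :=
  ⟨Set.inter_subset_right, fun p hp q hq hpq =>
    ⟨hD.2 p (properInt_mono hQR hp) q hq.1 ⟨hQR _ _ hpq.1, hQR _ _ hpq.2⟩, hp⟩⟩

variable {A : Type*} [Fintype A] [DecidableEq A] {F : Type*} [Field F] [Finite F]
  {Q R : PartialOrder A}

theorem apply_eq_zero_of_notMem_properInt {u : Matrix.GeneralLinearGroup A F}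
    (hu : u ∈ UT F Q) {p : A × A} (hp : p ∈ properInt R) (hpQ : p ∉ properInt Q) :
    u.val p.1 p.2 = 0 :=
  hu.2 _ _ fun hle => hpQ (@lt_of_le_of_ne A Q _ _ hle (@ne_of_lt A R.toPreorder _ _ hp))

theorem lowerUT_inf_UT (hQR : IsSubposet Q R) {D : Set (A × A)} (hD : IsLowerPart R D) :
    lowerUT F R D ⊓ UT F Q = lowerUT F Q (D ∩ properInt Q) := by
  ext u
  rw [Subgroup.mem_inf, hD.mem_lowerUT_iff, (hD.restrict hQR).mem_lowerUT_iff]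
  refine ⟨fun h => ⟨h.2, fun p hp => h.1.2 p hp.1⟩,
    fun h => ⟨⟨UT_mono F hQR h.1, fun p hp => ?_⟩, h.1⟩⟩
  by_cases hpQ : p ∈ properInt Q
  · exact h.2 p ⟨hp, hpQ⟩
  · exact apply_eq_zero_of_notMem_properInt h.1 (hD.1 hp) hpQ

/-- Lagrange's theorem, in a multiplicative form that avoids subtracting exponents. -/
theorem card_quotient_lowerUT_mul {D E : Set (A × A)} (hD : IsLowerPart R D)
    (hE : IsLowerPart R E) (h : E ⊆ D) :
    Nat.card (lowerUT F R E ⧸ (lowerUT F R D).subgroupOf (lowerUT F R E)) * Nat.card F ^ E.ncard =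
      Nat.card F ^ D.ncard := by
  have h1 := Subgroup.card_eq_card_quotient_mul_card_subgroup
    ((lowerUT F R D).subgroupOf (lowerUT F R E))
  rw [Nat.card_congr
    (Subgroup.subgroupOfEquivOfLe ((lowerUT_le_lowerUT_iff hD hE).2 h)).toEquiv] at h1
  have h2 := card_lowerUT_mul (F := F) hE
  rw [h1, ← card_lowerUT_mul hD] at h2
  refine Nat.eq_of_mul_eq_mul_left (Nat.card_pos (α := lowerUT F R D)) ?_
  rw [← h2]
  ring

end Restriction

theorem mainTheorem1 {A : Type*} [Fintype A] [DecidableEq A] (F : Type*) [Field F] [Finite F]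
    (Q R : PartialOrder A) (hQR : IsSubposet Q R)
    (lam : Set (A × A)) (hlam : lam ∈ nonNesting R) :
    superchar F R lam ∘ Subgroup.inclusion (UT_mono F hQR) =
      ((1 / (Nat.card (lowerUT F Q (restrictPart Q lam) ⧸
            (lowerUT F R lam ⊓ UT F Q).subgroupOf (lowerUT F Q (restrictPart Q lam))) : ℂ)) *
          (superchar F R lam 1 / superchar F Q (restrictPart Q lam) 1)) •
        ∑ᶠ nu ∈ {nu : Set (A × A) | nu ∈ nonNesting Q ∧
            lowerUT F Q nu ≤ lowerUT F Q (restrictPart Q lam) ∧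
            lowerUT F R lam ⊓ UT F Q ≤ lowerUT F Q nu},
          superchar F Q nu := by
  classical
  have hlamQ := restrictPart_mem_nonNesting hQR hlam
  have hD := isLowerPart_lowerPart R lam
  have hD' := hD.restrict hQR
  have hE := isLowerPart_lowerPart Q (restrictPart Q lam)
  -- Containment in `Q` implies containment in `R`, so `λ_Q` stays maximal in `D ∩ Int°(Q)`. It need
  -- not generate that lower set, which is why several `ν` can occur.
  have hmax : ∀ m ∈ restrictPart Q lam, m ∈ lowerPart R lam ∩ properInt Q ∧
      ∀ q ∈ lowerPart R lam ∩ properInt Q, IntLE Q m q → m = q := fun m hm =>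
    ⟨⟨subset_lowerPart hlam.1.1 hm.1, hm.2⟩, fun q hq h =>
      eq_of_mem_lowerPart hlam hm.1 hq.1 ⟨hQR _ _ h.1, hQR _ _ h.2⟩⟩
  have hinf : lowerUT F R lam ⊓ UT F Q = lowerUT F Q (lowerPart R lam ∩ properInt Q) := by
    rw [← lowerUT_lowerPart, lowerUT_inf_UT hQR hD]
  obtain ⟨M, rfl⟩ : ∃ M : Finset (A × A), (M : Set (A × A)) = lam :=
    ⟨lam.toFinite.toFinset, lam.toFinite.coe_toFinset⟩
  have hMQ : ((M.filter fun p => Q.lt p.1 p.2 : Finset (A × A)) : Set (A × A)) =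
      restrictPart Q M := by
    ext p
    simp [restrictPart]
  have hcard := card_quotient_lowerUT_mul (F := F) hD' hE
    (lowerPart_subset hD' fun m hm => (hmax m hm).1)
  rw [lowerUT_lowerPart] at hcard
  funext h
  rw [hinf, Function.comp_apply, Pi.smul_apply, finsum_superchar_apply hD' hlamQ hmax hMQ,
    finsum_partBlock _ _ hD' (by simpa only [← hMQ, Finset.mem_coe] using hmax),
    superchar_apply_one hlam rfl, superchar_apply_one hlamQ hMQ, superchar_apply hlam rfl,
    smul_eq_mul]
  have hval : ∀ p : A × A,
      (Subgroup.inclusion (UT_mono F hQR) h).1.val p.1 p.2 = h.1.val p.1 p.2 := fun _ => rfl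
  simp only [hval]
  have hcond : (∀ p ∈ lowerPart R M, p ∉ M → h.1.val p.1 p.2 = 0) ↔
      ∀ p ∈ lowerPart R M ∩ properInt Q, p ∉ M.filter (fun p => Q.lt p.1 p.2) →
        h.1.val p.1 p.2 = 0 := by
    refine ⟨fun H p hp hn => H p hp.1 fun hpM => hn (Finset.mem_filter.2 ⟨hpM, hp.2⟩),
      fun H p hp hn => ?_⟩
    by_cases hpQ : p ∈ properInt Q
    · exact H p ⟨hp, hpQ⟩ fun hpM => hn (Finset.mem_filter.1 hpM).1
    · exact apply_eq_zero_of_notMem_properInt h.2 hp.1 hpQ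
  rw [← Finset.prod_filter_mul_prod_filter_not M (fun p => Q.lt p.1 p.2),
    ← Finset.card_filter_add_card_filter_not (s := M) (fun p => Q.lt p.1 p.2), pow_add]
  -- At these positions every element of `UT_Q` vanishes, so the factors are constant and match the
  -- surplus in `χ^λ(1) / χ^{λ_Q}(1)`.
  have hprod : ∏ m ∈ M with ¬ Q.lt m.1 m.2,
      ((if h.1.val m.1 m.2 = 0 then 1 else 0) - (Nat.card F : ℂ)⁻¹) =
        (1 - (Nat.card F : ℂ)⁻¹) ^ (M.filter fun p => ¬ Q.lt p.1 p.2).card := by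
    rw [← Finset.prod_const]
    refine Finset.prod_congr rfl fun m hm => ?_
    rw [Finset.mem_filter] at hm
    rw [if_pos (apply_eq_zero_of_notMem_properInt h.2 (hlam.1.1 hm.1) hm.2)]
  rw [hprod]
  simp only [hcond]
  have hq : (Nat.card F : ℂ) ≠ 0 := by exact_mod_cast Nat.card_pos.ne'
  -- Together with `hq`, this makes `χ^{λ_Q}(1)` nonzero, so the division is genuine.
  have ht : 1 - (Nat.card F : ℂ)⁻¹ ≠ 0 := by
    rw [sub_ne_zero, ne_comm, Ne, inv_eq_one]
    exact_mod_cast (Finite.one_lt_card (α := F)).ne'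
  have hcard' := congrArg (Nat.cast : ℕ → ℂ) hcard
  push_cast at hcard'
  rw [← hcard']
  have hX : (Nat.card (lowerUT F Q (restrictPart Q M) ⧸
      (lowerUT F Q (lowerPart R M ∩ properInt Q)).subgroupOf
        (lowerUT F Q (restrictPart Q M))) : ℂ) ≠ 0 := by
    exact_mod_cast Nat.card_pos.ne'
  generalize ∏ m ∈ M with Q.lt m.1 m.2,
      ((if h.1.val m.1 m.2 = 0 then 1 else 0) - (Nat.card F : ℂ)⁻¹) = P
  generalize 1 - (Nat.card F : ℂ)⁻¹ = t at ht ⊢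
  field_simp
  ring_nf
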